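/- Let $n\ge 0$, let $A,N,B$ be $n\times n$ complex matrices with $N$ normal, and let $$\mathbb T=\begin{pmatrix}A&N\\0&B\end{pmatrix},$$ a $2n\times 2n$ matrix. Let $f:[0,\infty)\to[0,\infty)$ be concave and e-convex, where e-convex means that $t\mapsto f(e^t)$ is convex on $(-\infty,\infty)$. A symmetric (unitarily invariant) norm is a norm on square complex matrices with $\|UXV\|=\|X\|$ for all matrices $X$ and all unitaries $U,V$; write $|X|=(X^*X)^{1/2}$. Then for every symmetric norm $\|\cdot\|$ on the $2n\times 2n$ matrices, $$\|f(|\mathbb T|)\|\le \|\,f(|A^*|)+f(|N|)+f(|B|)\,\|,$$ where, as usual, an $n\times n$ matrix $Y$ is identified with the $2n\times 2n$ matrix $Y\oplus 0$ on the right-hand side, i.e. $\|Y\|:=\left\|\begin{pmatrix}Y&0\\0&0\end{pmatrix}\right\|$. -/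

import Mathlib

open Set

/-- A norm `p` on the space of square complex matrices (a seminorm that vanishes only at `0`) is
*symmetric*, or *unitarily invariant*, if `p (U * A * V) = p A` for all matrices `A` and all
unitaries `U`, `V`. -/
structure IsSymmetricNorm {m : Type*} [Fintype m] [DecidableEq m]
    (p : Seminorm ℂ (Matrix m m ℂ)) : Prop where
  eq_zero_of_map_eq_zero : ∀ A : Matrix m m ℂ, p A = 0 → A = 0
  unitary_invariant : ∀ U ∈ Matrix.unitaryGroup m ℂ, ∀ V ∈ Matrix.unitaryGroup m ℂ,
    ∀ A : Matrix m m ℂ, p (U * A * V) = p A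

/-- A function `f` on `[0, ∞)` is *e-convex* if `t ↦ f (exp t)` is convex on the real line. -/
def EConvex (f : ℝ → ℝ) : Prop :=
  ConvexOn ℝ univ (fun t : ℝ => f (Real.exp t))

section

open scoped MatrixOrder Matrix.Norms.L2Operator

/-- `f(|A|)`: the function `f` applied to `|A| = (Aᴴ * A) ^ (1/2)` by functional calculus. The
spectrum of `|A|` lies in `[0, ∞)`, so only the values of `f` on `[0, ∞)` matter; as it is finite,
no continuity of `f` is needed. -/
noncomputable def funAbs {m : Type*} [Fintype m] [DecidableEq m] (f : ℝ → ℝ)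
    (A : Matrix m m ℂ) : Matrix m m ℂ :=
  cfc f (CFC.abs A)

end

/-- The value of a norm `p` on matrices of doubled size at a matrix `X` of the original size,
where `X` is identified with `X ⊕ 0`. -/
noncomputable def padNorm {n : Type*} [Fintype n] [DecidableEq n]
    (p : Seminorm ℂ (Matrix (n ⊕ n) (n ⊕ n) ℂ)) (X : Matrix n n ℂ) : ℝ :=
  p (Matrix.fromBlocks X 0 0 0)

/-! Factor 𝕋 = XY through a 3n-dimensional space, splitting each of A, N, B by its polar
decomposition, so that XX* = (|A*| ⊕ |B*|) + (|N*| ⊕ 0) and Y*Y = (|A| ⊕ |N|) + (0 ⊕ |B|). By Horn's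
inequality (`prod_sq_le_of_mul`) the initial products of the squared singular values s_j² of 𝕋 are
at most those of α_jβ_j, where α and β are the eigenvalues of XX* and Y*Y. Since f is nondecreasing
and e-convex, the initial sums of f(s_j) are at most those of (f(α_j) + f(β_j))/2
(`EConvex.sum_le_of_prod_le`).

Concavity then splits XX* = A₁ + B₁: the initial sums of f(α_j) are at most those of the sorted
eigenvalues of any C₁ ≥ f(A₁) + f(B₁) - f(0) (`sum_concave_add_le` with Ky Fan's maximum principle),
and likewise for Y*Y. The term -f(0) pays for the zero blocks, on which the functional calculus
gives f(0) rather than 0. As |N*| = |N|, one may take C₁ = (f(|A*|) + f(|N|)) ⊕ f(|B*|) and C₂ =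
f(|A|) ⊕ (f(|N|) + f(|B|)).

Ky Fan dominance (`IsSymmetricNorm.realDiag_le`) bounds the norm of f(|𝕋|) by the average of the
norms of C₁ and C₂. Inside its own block f(|B*|) may be replaced by f(|B|), and f(|A|) by f(|A*|).
Finally ‖P ⊕ Q‖ ≤ ‖P + Q‖ for P, Q ≥ 0 (`IsSymmetricNorm.fromBlocks_le_padNorm`) sends both norms to
the same right-hand side. -/

open Matrix in
/-- A matrix with orthonormal columns and orthonormal rows; the two index types may differ. -/
structure IsUnitaryFrame {m ι : Type*} [Fintype m] [DecidableEq m] [Fintype ι] [DecidableEq ι]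
    (U : Matrix m ι ℂ) : Prop where
  conjTranspose_mul_self : Uᴴ * U = 1
  mul_conjTranspose_self : U * Uᴴ = 1

/-! ### Diagonalization, singular values and functional calculus in unitary frames. -/

section Frames

open Matrix
open scoped ComplexOrder

set_option linter.unusedSectionVars false

variable {m ι κ : Type*} [Fintype m] [DecidableEq m] [Fintype ι] [DecidableEq ι]
  [Fintype κ] [DecidableEq κ]

/-- The real diagonal matrix `d`, with complex entries. -/
noncomputable def realDiag (d : ι → ℝ) : Matrix ι ι ℂ := diagonal fun i => (d i : ℂ)

theorem realDiag_conjTranspose (d : ι → ℝ) : (realDiag d)ᴴ = realDiag d := by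
  rw [realDiag, diagonal_conjTranspose]
  congr 1
  ext i
  simp

theorem realDiag_mul_realDiag (d e : ι → ℝ) :
    realDiag d * realDiag e = realDiag fun i => d i * e i := by
  simp [realDiag, diagonal_mul_diagonal]

theorem realDiag_add (d e : ι → ℝ) :
    realDiag (fun i => d i + e i) = realDiag d + realDiag e := by
  simp [realDiag, diagonal_add]

theorem realDiag_smul (c : ℝ) (d : ι → ℝ) :
    realDiag (fun i => c * d i) = (c : ℂ) • realDiag d := by
  ext i j
  by_cases h : i = j <;> simp [realDiag, h]

namespace IsUnitaryFrame

theorem mul {U : Matrix m ι ℂ} {V : Matrix ι κ ℂ} (hU : IsUnitaryFrame U)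
    (hV : IsUnitaryFrame V) : IsUnitaryFrame (U * V) where
  conjTranspose_mul_self := by
    rw [conjTranspose_mul, Matrix.mul_assoc, ← Matrix.mul_assoc Uᴴ, hU.1, Matrix.one_mul, hV.1]
  mul_conjTranspose_self := by
    rw [conjTranspose_mul, Matrix.mul_assoc, ← Matrix.mul_assoc V, hV.2, Matrix.one_mul, hU.2]

theorem conjTranspose {U : Matrix m ι ℂ} (hU : IsUnitaryFrame U) : IsUnitaryFrame Uᴴ where
  conjTranspose_mul_self := by rw [conjTranspose_conjTranspose, hU.2]
  mul_conjTranspose_self := by rw [conjTranspose_conjTranspose, hU.1]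

theorem submatrix {U : Matrix m ι ℂ} (hU : IsUnitaryFrame U) (e : κ ≃ ι) :
    IsUnitaryFrame (U.submatrix id e) where
  conjTranspose_mul_self := by
    rw [conjTranspose_submatrix, ← submatrix_mul _ _ e id e Function.bijective_id, hU.1,
      submatrix_one_equiv]
  mul_conjTranspose_self := by
    rw [conjTranspose_submatrix, submatrix_mul_equiv, hU.2, submatrix_id_id]

theorem fromBlocks {m' ι' : Type*} [Fintype m'] [DecidableEq m'] [Fintype ι'] [DecidableEq ι']
    {U : Matrix m ι ℂ} {V : Matrix m' ι' ℂ} (hU : IsUnitaryFrame U) (hV : IsUnitaryFrame V) :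
    IsUnitaryFrame (fromBlocks U 0 0 V) where
  conjTranspose_mul_self := by
    simp [fromBlocks_conjTranspose, fromBlocks_multiply, hU.1, hV.1]
  mul_conjTranspose_self := by
    simp [fromBlocks_conjTranspose, fromBlocks_multiply, hU.2, hV.2]

theorem of_mem_unitaryGroup {U : Matrix m m ℂ} (hU : U ∈ unitaryGroup m ℂ) :
    IsUnitaryFrame U :=
  ⟨mem_unitaryGroup_iff'.1 hU, mem_unitaryGroup_iff.1 hU⟩

theorem mem_unitaryGroup {U : Matrix m m ℂ} (hU : IsUnitaryFrame U) :
    U ∈ unitaryGroup m ℂ :=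
  mem_unitaryGroup_iff.2 hU.2

end IsUnitaryFrame

theorem exists_equiv_fin_antitone {N : ℕ} (hN : Fintype.card ι = N) (d : ι → ℝ) :
    ∃ e : Fin N ≃ ι, Antitone (d ∘ e) := by
  let e₀ := (Fintype.equivFinOfCardEq hN).symm
  refine ⟨(Tuple.sort (fun i => -(d (e₀ i)))).trans e₀, ?_⟩
  intro i j hij
  have := Tuple.monotone_sort (fun i => -(d (e₀ i))) hij
  simpa using this

theorem mul_realDiag_mul_submatrix (U V : Matrix m ι ℂ) (d : ι → ℝ) (e : κ ≃ ι) :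
    U.submatrix id e * realDiag (d ∘ e) * (V.submatrix id e)ᴴ = U * realDiag d * Vᴴ := by
  have : realDiag (d ∘ e) = (realDiag d).submatrix e e := by
    ext i j
    simp [realDiag, diagonal_apply]
  rw [this, conjTranspose_submatrix, submatrix_mul_equiv, submatrix_mul_equiv, submatrix_id_id]

theorem aeval_realDiag (q : Polynomial ℝ) (d : ι → ℝ) :
    Polynomial.aeval (realDiag d) q = realDiag fun i => q.eval (d i) := by
  induction q using Polynomial.induction_on' with
  | add p q hp hq => rw [map_add, hp, hq, ← realDiag_add]; simp
  | monomial k a =>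
    rw [Polynomial.aeval_monomial, realDiag, diagonal_pow]
    ext i j
    by_cases h : i = j <;> simp [realDiag, h, Algebra.algebraMap_eq_smul_one]

theorem aeval_conj_isUnitaryFrame {U : Matrix m ι ℂ} (hU : IsUnitaryFrame U)
    (D : Matrix ι ι ℂ) (q : Polynomial ℝ) :
    Polynomial.aeval (U * D * Uᴴ) q = U * Polynomial.aeval D q * Uᴴ := by
  induction q using Polynomial.induction_on' with
  | add p q hp hq => simp [map_add, hp, hq, Matrix.mul_add, Matrix.add_mul]
  | monomial k a =>
    have key : (U * D * Uᴴ) ^ k = U * D ^ k * Uᴴ := by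
      induction k with
      | zero => simp [hU.2]
      | succ k ih =>
        rw [pow_succ, ih, pow_succ]
        calc U * D ^ k * Uᴴ * (U * D * Uᴴ) = U * D ^ k * (Uᴴ * U) * D * Uᴴ := by
              simp only [Matrix.mul_assoc]
          _ = _ := by rw [hU.1]; simp only [Matrix.mul_assoc, Matrix.mul_one]
    rw [Polynomial.aeval_monomial, Polynomial.aeval_monomial, key]
    simp [Algebra.algebraMap_eq_smul_one]

theorem isHermitian_conj_realDiag (U : Matrix m ι ℂ) (d : ι → ℝ) :
    (U * realDiag d * Uᴴ).IsHermitian := by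
  simp only [IsHermitian, conjTranspose_mul, conjTranspose_conjTranspose, realDiag_conjTranspose,
    Matrix.mul_assoc]

theorem posSemidef_conj_realDiag (U : Matrix m ι ℂ) {d : ι → ℝ} (hd : ∀ i, 0 ≤ d i) :
    (U * realDiag d * Uᴴ).PosSemidef := by
  have : (realDiag d).PosSemidef := by
    rw [realDiag, posSemidef_diagonal_iff]
    intro i
    exact_mod_cast hd i
  exact this.mul_mul_conjTranspose_same U

section

open scoped MatrixOrder Matrix.Norms.L2Operator

/-- On a finite spectrum f agrees with a Lagrange interpolant, and polynomials commute with unitary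
conjugation. -/
theorem cfc_conj_realDiag {U : Matrix m ι ℂ} (hU : IsUnitaryFrame U) (d : ι → ℝ) (f : ℝ → ℝ) :
    cfc f (U * realDiag d * Uᴴ) = U * realDiag (fun i => f (d i)) * Uᴴ := by
  classical
  set M := U * realDiag d * Uᴴ with hM
  have hMh : M.IsHermitian := isHermitian_conj_realDiag U d
  -- Taking both the spectrum and the entries of `d` as nodes avoids having to identify the two
  -- sets.
  let S : Finset ℝ := M.finite_real_spectrum.toFinset ∪ Finset.univ.image d
  let q := Lagrange.interpolate S id f
  have hq : ∀ x ∈ S, q.eval x = f x := fun x hx =>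
    Lagrange.eval_interpolate_at_node f (Set.injOn_id _) hx
  have h1 : cfc f M = cfc (fun x => q.eval x) M := by
    refine cfc_congr fun x hx => (hq x ?_).symm
    exact Finset.mem_union_left _ (by simpa using hx)
  rw [h1, cfc_polynomial q M hMh.isSelfAdjoint, hM, aeval_conj_isUnitaryFrame hU, aeval_realDiag]
  congr 3
  ext i
  exact hq _ (Finset.mem_union_right _ (Finset.mem_image_of_mem _ (Finset.mem_univ i)))

theorem funAbs_mul_realDiag_mul {U V : Matrix m ι ℂ} (hU : IsUnitaryFrame U)
    (hV : IsUnitaryFrame V) {s : ι → ℝ} (hs : ∀ i, 0 ≤ s i) (f : ℝ → ℝ) :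
    funAbs f (U * realDiag s * Vᴴ) = V * realDiag (fun i => f (s i)) * Vᴴ := by
  have habs : CFC.abs (U * realDiag s * Vᴴ) = V * realDiag s * Vᴴ := by
    rw [CFC.abs, CFC.sqrt_eq_iff (ha := star_mul_self_nonneg _)
      (hb := (posSemidef_conj_realDiag V hs).nonneg)]
    have : star (U * realDiag s * Vᴴ) = V * realDiag s * Uᴴ := by
      simp only [star_eq_conjTranspose, conjTranspose_mul, conjTranspose_conjTranspose,
        realDiag_conjTranspose, Matrix.mul_assoc]
    rw [this]
    calc V * realDiag s * Vᴴ * (V * realDiag s * Vᴴ)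
        = V * realDiag s * (Vᴴ * V) * realDiag s * Vᴴ := by simp only [Matrix.mul_assoc]
      _ = V * realDiag s * (Uᴴ * U) * realDiag s * Vᴴ := by rw [hU.1, hV.1]
      _ = _ := by simp only [Matrix.mul_assoc]
  rw [funAbs, habs, cfc_conj_realDiag hV]

end

theorem exists_conj_realDiag {M : Matrix m m ℂ} (hM : M.IsHermitian) :
    ∃ (U : Matrix m m ℂ), IsUnitaryFrame U ∧ M = U * realDiag hM.eigenvalues * Uᴴ := by
  refine ⟨hM.eigenvectorUnitary, .of_mem_unitaryGroup hM.eigenvectorUnitary.2, ?_⟩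
  conv_lhs => rw [hM.spectral_theorem]
  rfl

theorem exists_sorted_conj_realDiag {N : ℕ} (hN : Fintype.card m = N) {M : Matrix m m ℂ}
    (hM : M.PosSemidef) :
    ∃ (U : Matrix m (Fin N) ℂ) (d : Fin N → ℝ), IsUnitaryFrame U ∧ Antitone d ∧
      (∀ i, 0 ≤ d i) ∧ M = U * realDiag d * Uᴴ := by
  obtain ⟨U, hU, hUM⟩ := exists_conj_realDiag hM.1
  obtain ⟨e, he⟩ := exists_equiv_fin_antitone hN hM.1.eigenvalues
  refine ⟨U.submatrix id e, hM.1.eigenvalues ∘ e, hU.submatrix e, he,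
    fun i => hM.eigenvalues_nonneg _, ?_⟩
  rw [mul_realDiag_mul_submatrix, ← hUM]

/-- If V diagonalizes A*A, the columns of AV are orthogonal with norms `s`; the nonzero ones are
normalized and extended to an orthonormal basis. -/
theorem exists_svd (A : Matrix m m ℂ) :
    ∃ (U V : Matrix m m ℂ) (s : m → ℝ), IsUnitaryFrame U ∧ IsUnitaryFrame V ∧
      (∀ i, 0 ≤ s i) ∧ A = U * realDiag s * Vᴴ := by
  have hP := posSemidef_conjTranspose_mul_self A
  obtain ⟨V, hV, hVA⟩ := exists_conj_realDiag hP.1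
  set d := hP.1.eigenvalues
  have hd : ∀ i, 0 ≤ d i := hP.eigenvalues_nonneg
  set s : m → ℝ := fun i => Real.sqrt (d i)
  have hs : ∀ i, s i * s i = d i := fun i => Real.mul_self_sqrt (hd i)
  set W := A * V with hW
  have hWW : Wᴴ * W = realDiag d := by
    rw [hW, conjTranspose_mul]
    calc Vᴴ * Aᴴ * (A * V) = Vᴴ * (Aᴴ * A) * V := by simp only [Matrix.mul_assoc]
      _ = (Vᴴ * V) * realDiag d * (Vᴴ * V) := by rw [hVA]; simp only [Matrix.mul_assoc]
      _ = _ := by rw [hV.1, Matrix.one_mul, Matrix.mul_one]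
  let v : m → EuclideanSpace ℂ m := fun i => WithLp.toLp 2 fun a => ((s i)⁻¹ : ℂ) * W a i
  have hinner : ∀ i j, inner ℂ (v i) (v j) = ((s i)⁻¹ : ℂ) * (s j)⁻¹ * (realDiag d i j) := by
    intro i j
    rw [← hWW]
    simp only [v, PiLp.inner_apply, Matrix.mul_apply, conjTranspose_apply, Finset.mul_sum]
    refine Finset.sum_congr rfl fun a _ => ?_
    simp
    ring
  have hv : Orthonormal ℂ (({i | s i ≠ 0} : Set m).domRestrict v) := by
    rw [orthonormal_iff_ite]
    rintro ⟨i, hi⟩ ⟨j, hj⟩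
    simp only [Set.domRestrict_apply, hinner, Subtype.mk.injEq]
    by_cases hij : i = j
    · subst hij
      have hi' : (s i : ℂ) ≠ 0 := by exact_mod_cast hi
      simp only [realDiag, diagonal_apply_eq, ← hs, if_true]
      push_cast
      field_simp
    · simp [realDiag, hij]
  obtain ⟨b, hb⟩ := hv.exists_orthonormalBasis_extension_of_card_eq (by simp)
  have hU1 : (of fun a i => b i a : Matrix m m ℂ)ᴴ * (of fun a i => b i a) = 1 := by
    ext i j
    have := orthonormal_iff_ite.1 b.orthonormal i j
    rw [Matrix.one_apply, ← this]
    simp [Matrix.mul_apply, PiLp.inner_apply, mul_comm]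
  refine ⟨of fun a i => b i a, V, s, ⟨hU1, mul_eq_one_comm.1 hU1⟩, hV,
    fun i => Real.sqrt_nonneg _, ?_⟩
  have hWU : W = (of fun a i => b i a) * realDiag s := by
    ext a i
    simp only [realDiag, mul_diagonal, of_apply]
    -- Where s_i = 0 the basis vector is arbitrary, but the corresponding column of W is itself
    -- zero.
    by_cases hi : s i = 0
    · have h0 : ∑ a, ‖W a i‖ ^ 2 = 0 := by
        have := congrFun (congrFun hWW i) i
        rw [realDiag, diagonal_apply_eq, ← hs, hi, mul_zero, Matrix.mul_apply] at this
        simp only [conjTranspose_apply, RCLike.star_def, Complex.conj_mul'] at this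
        exact_mod_cast this
      have := (Finset.sum_eq_zero_iff_of_nonneg (fun a _ => by positivity)).1 h0 a
        (Finset.mem_univ _)
      simp [hi] at this ⊢
      exact this
    · have hi' : (s i : ℂ) ≠ 0 := by exact_mod_cast hi
      rw [hb i hi]
      simp only [v]
      field_simp
  rw [← hWU, hW, Matrix.mul_assoc, hV.2, Matrix.mul_one]

theorem exists_sorted_svd {N : ℕ} (hN : Fintype.card m = N) (A : Matrix m m ℂ) :
    ∃ (U V : Matrix m (Fin N) ℂ) (s : Fin N → ℝ), IsUnitaryFrame U ∧ IsUnitaryFrame V ∧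
      Antitone s ∧ (∀ i, 0 ≤ s i) ∧ A = U * realDiag s * Vᴴ := by
  obtain ⟨U, V, s, hU, hV, hs, hA⟩ := exists_svd A
  obtain ⟨e, he⟩ := exists_equiv_fin_antitone hN s
  exact ⟨U.submatrix id e, V.submatrix id e, s ∘ e, hU.submatrix e, hV.submatrix e, he,
    fun i => hs _, by rw [mul_realDiag_mul_submatrix, ← hA]⟩

theorem IsSymmetricNorm.frame_eq {p : Seminorm ℂ (Matrix m m ℂ)} (hp : IsSymmetricNorm p)
    {U V : Matrix m ι ℂ} {U' V' : Matrix m ι ℂ} (hU : IsUnitaryFrame U) (hV : IsUnitaryFrame V)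
    (hU' : IsUnitaryFrame U') (hV' : IsUnitaryFrame V') (D : Matrix ι ι ℂ) :
    p (U * D * Vᴴ) = p (U' * D * V'ᴴ) := by
  have := hp.unitary_invariant (U' * Uᴴ) (hU'.mul hU.conjTranspose).mem_unitaryGroup
    (V * V'ᴴ) (hV.mul hV'.conjTranspose).mem_unitaryGroup (U * D * Vᴴ)
  rw [← this]
  congr 1
  calc U' * Uᴴ * (U * D * Vᴴ) * (V * V'ᴴ) = U' * (Uᴴ * U) * D * (Vᴴ * V) * V'ᴴ := by
        simp only [Matrix.mul_assoc]
    _ = _ := by rw [hU.1, hV.1, Matrix.mul_one, Matrix.mul_one]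

end Frames

/-! ### Weak majorization and Ky Fan dominance. -/

section Majorization

/-- Summation by parts: an antitone nonnegative weight preserves nonnegativity of all initial
sums. -/
theorem sum_mul_nonneg_of_antitone {N : ℕ} {w d : Fin N → ℝ} (hw : Antitone w)
    (hw0 : ∀ i, 0 ≤ w i)
    (hd : ∀ (k : ℕ) (hk : k ≤ N), 0 ≤ ∑ i : Fin k, d (Fin.castLE hk i)) :
    0 ≤ ∑ i, w i * d i := by
  induction N with
  | zero => simp
  | succ N ih =>
    have h1 := ih (w := fun i => w i.castSucc - w (Fin.last N)) (d := fun i => d i.castSucc)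
      (fun i j hij => sub_le_sub_right (hw (Fin.castSucc_le_castSucc_iff.2 hij)) _)
      (fun i => sub_nonneg.2 (hw (Fin.le_last _)))
      (fun k hk => hd k (hk.trans N.le_succ))
    have h2 : 0 ≤ w (Fin.last N) * ∑ i, d i := mul_nonneg (hw0 _) (hd (N + 1) le_rfl)
    have h3 : ∑ i, w i * d i = (∑ i : Fin N, (w i.castSucc - w (Fin.last N)) * d i.castSucc) +
        w (Fin.last N) * ∑ i, d i := by
      rw [Fin.sum_univ_castSucc, Fin.sum_univ_castSucc d, mul_add, Finset.mul_sum, ← add_assoc,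
        ← Finset.sum_add_distrib]
      congr 1
      exact Finset.sum_congr rfl fun i _ => by ring
    linarith

/-- A nonnegative antitone vector that is weakly majorized by an antitone vector `y` is a convex
combination of signed permutations of `y`. -/
theorem mem_convexHull_signed_perm {N : ℕ} {x y : Fin N → ℝ} (hx : Antitone x)
    (hx0 : ∀ i, 0 ≤ x i)
    (h : ∀ (k : ℕ) (hk : k ≤ N),
      ∑ i : Fin k, x (Fin.castLE hk i) ≤ ∑ i : Fin k, y (Fin.castLE hk i)) :
    x ∈ convexHull ℝ (range fun σ : Equiv.Perm (Fin N) × (Fin N → ℤˣ) =>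
      fun i => ((σ.2 i : ℤ) : ℝ) * y (σ.1 i)) := by
  by_contra hmem
  -- Otherwise a linear functional separates x strictly from the hull. Matching the signs of its
  -- coefficients and sorting their moduli picks a vertex that contradicts this, by rearrangement
  -- and summation by parts.
  obtain ⟨φ, u, hφ, hu⟩ := geometric_hahn_banach_closed_point (convex_convexHull ℝ _)
    ((finite_range _).isClosed_convexHull (𝕜 := ℝ)) hmem
  set c : Fin N → ℝ := fun i => φ (fun j => if i = j then 1 else 0)
  have hc : ∀ z, φ z = ∑ i, c i * z i := fun z => by
    have := LinearMap.pi_apply_eq_sum_univ (φ : (Fin N → ℝ) →ₗ[ℝ] ℝ) z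
    simpa [mul_comm, c] using this
  obtain ⟨τ, hτ⟩ := exists_equiv_fin_antitone (Fintype.card_fin N) fun i => |c i|
  let ε : Fin N → ℤˣ := fun i => if 0 ≤ c i then 1 else -1
  have hε : ∀ i, c i * ((ε i : ℤ) : ℝ) = |c i| := fun i => by
    by_cases hi : 0 ≤ c i
    · simp [ε, hi, abs_of_nonneg]
    · simp [ε, hi, abs_of_neg (not_le.1 hi)]
  have h1 := hφ _ (subset_convexHull ℝ _ ⟨(τ.symm, ε), rfl⟩)
  have h2 : φ (fun i => ((ε i : ℤ) : ℝ) * y (τ.symm i)) = ∑ j, |c (τ j)| * y j := by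
    rw [hc, ← τ.sum_comp]
    refine Finset.sum_congr rfl fun i _ => ?_
    rw [← hε, Equiv.symm_apply_apply]
    ring
  have h3 : φ x ≤ ∑ j, |c (τ j)| * x j := by
    calc φ x = ∑ i, c i * x i := hc x
      _ ≤ ∑ i, |c i| * x i :=
        Finset.sum_le_sum fun i _ => mul_le_mul_of_nonneg_right (le_abs_self _) (hx0 i)
      _ = ∑ j, |c (τ j)| * x (τ j) := (τ.sum_comp fun i => |c i| * x i).symm
      _ ≤ _ := (hτ.monovary hx).sum_mul_comp_perm_le_sum_mul (σ := τ)
  have h4 := sum_mul_nonneg_of_antitone hτ (fun _ => abs_nonneg _) (d := fun i => y i - x i)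
    fun k hk => by
      rw [Finset.sum_sub_distrib]
      exact sub_nonneg.2 (h k hk)
  simp only [Function.comp_apply, mul_sub, Finset.sum_sub_distrib] at h4
  linarith

open Matrix

variable {m : Type*} [Fintype m] [DecidableEq m] {N : ℕ}

theorem isUnitaryFrame_mul_sign {U : Matrix m (Fin N) ℂ} (hU : IsUnitaryFrame U)
    (ε : Fin N → ℤˣ) : IsUnitaryFrame (U * realDiag fun i => ((ε i : ℤ) : ℝ)) := by
  have h1 : (realDiag fun i => ((ε i : ℤ) : ℝ)) * (realDiag fun i => ((ε i : ℤ) : ℝ)) = 1 := by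
    rw [realDiag_mul_realDiag, realDiag, ← diagonal_one]
    congr 1
    ext i
    rcases Int.units_eq_one_or (ε i) with h | h <;> simp [h]
  exact hU.mul ⟨by rw [realDiag_conjTranspose, h1], by rw [realDiag_conjTranspose, h1]⟩

/-- **Ky Fan dominance principle**: a symmetric norm is monotone for weak majorization of singular
values. -/
theorem IsSymmetricNorm.realDiag_le {p : Seminorm ℂ (Matrix m m ℂ)} (hp : IsSymmetricNorm p)
    {U : Matrix m (Fin N) ℂ} (hU : IsUnitaryFrame U) {x y : Fin N → ℝ} (hx : Antitone x)
    (hx0 : ∀ i, 0 ≤ x i)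
    (h : ∀ (k : ℕ) (hk : k ≤ N),
      ∑ i : Fin k, x (Fin.castLE hk i) ≤ ∑ i : Fin k, y (Fin.castLE hk i)) :
    p (U * realDiag x * Uᴴ) ≤ p (U * realDiag y * Uᴴ) := by
  have hconv : Convex ℝ {z : Fin N → ℝ | p (U * realDiag z * Uᴴ) ≤ p (U * realDiag y * Uᴴ)} := by
    intro z hz w hw a b ha hb hab
    have h1 : U * realDiag (a • z + b • w) * Uᴴ =
        (a : ℂ) • (U * realDiag z * Uᴴ) + (b : ℂ) • (U * realDiag w * Uᴴ) := by
      have : realDiag (a • z + b • w) = (a : ℂ) • realDiag z + (b : ℂ) • realDiag w := by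
        rw [← realDiag_smul, ← realDiag_smul, ← realDiag_add]
        rfl
      rw [this]
      simp [Matrix.mul_add, Matrix.add_mul]
    rw [mem_ofPred_eq] at hz hw ⊢
    rw [h1]
    refine (map_add_le_add p _ _).trans ?_
    rw [map_smul_eq_mul, map_smul_eq_mul, Complex.norm_real, Complex.norm_real,
      Real.norm_of_nonneg ha, Real.norm_of_nonneg hb]
    calc _ ≤ a * p (U * realDiag y * Uᴴ) + b * p (U * realDiag y * Uᴴ) := by gcongr
      _ = _ := by rw [← add_mul, hab, one_mul]
  refine convexHull_min ?_ hconv (mem_convexHull_signed_perm hx hx0 h)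
  -- At a vertex the norm equals that of y: the signs are absorbed into the left frame, the
  -- permutation into both.
  rintro _ ⟨⟨σ, ε⟩, rfl⟩
  rw [mem_ofPred_eq]
  refine le_of_eq ?_
  have hσ := hU.submatrix σ
  simp only
  rw [← realDiag_mul_realDiag (fun i => ((ε i : ℤ) : ℝ)) fun i => y (σ i), ← Matrix.mul_assoc,
    hp.frame_eq (isUnitaryFrame_mul_sign hU ε) hU hσ hσ]
  exact congrArg p (mul_realDiag_mul_submatrix U U y σ)

end Majorization

/-! ### Determinant inequalities leading to Horn's inequality. -/

section Determinants

open Matrix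
open scoped ComplexOrder

set_option linter.unusedSectionVars false

variable {m ι κ : Type*} [Fintype m] [DecidableEq m] [Fintype ι] [DecidableEq ι]
  [Fintype κ] [DecidableEq κ]

theorem norm_det_conj_realDiag {U : Matrix m m ℂ} (hU : IsUnitaryFrame U) (d : m → ℝ) :
    ‖(U * realDiag d * Uᴴ).det‖ = ∏ i, |d i| := by
  rw [det_mul, det_mul, mul_right_comm, ← det_mul, hU.2, det_one, one_mul, realDiag, det_diagonal,
    norm_prod]
  simp

theorem one_le_norm_det_one_add {W : Matrix m m ℂ} (hW : W.PosSemidef) :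
    1 ≤ ‖(1 + W).det‖ := by
  obtain ⟨U, hU, hUW⟩ := exists_conj_realDiag hW.1
  have h1 : 1 + W = U * realDiag (fun i => 1 + hW.1.eigenvalues i) * Uᴴ := by
    have : realDiag (fun _ : m => (1 : ℝ)) = 1 := by simp [realDiag]
    rw [realDiag_add, this, Matrix.mul_add, Matrix.add_mul, Matrix.mul_one, hU.2, ← hUW]
  rw [h1, norm_det_conj_realDiag hU]
  refine Finset.one_le_prod fun i _ => ?_
  have := hW.eigenvalues_nonneg i
  rw [abs_of_nonneg (by linarith)]
  linarith

theorem exists_isHermitian_mul_self {M : Matrix m m ℂ} (hM : M.PosSemidef) :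
    ∃ F : Matrix m m ℂ, Fᴴ = F ∧ M = Fᴴ * F := by
  obtain ⟨U, hU, hUM⟩ := exists_conj_realDiag hM.1
  set D := realDiag fun i => Real.sqrt (hM.1.eigenvalues i) with hD
  have hF : (U * D * Uᴴ)ᴴ = U * D * Uᴴ := isHermitian_conj_realDiag _ _
  refine ⟨U * D * Uᴴ, hF, ?_⟩
  have hDD : D * D = realDiag hM.1.eigenvalues := by
    rw [hD, realDiag_mul_realDiag]
    simp only [Real.mul_self_sqrt (hM.eigenvalues_nonneg _)]
  rw [hF]
  calc M = U * (D * D) * Uᴴ := by rw [hDD]; exact hUM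
    _ = U * D * (Uᴴ * U) * D * Uᴴ := by rw [hU.1, Matrix.mul_one, Matrix.mul_assoc U D D]
    _ = _ := by simp only [Matrix.mul_assoc]

/-- With K = J*J, the larger matrix is L = J*(1 + W)J for some W ≥ 0, and |det(1 + W)| ≥ 1. -/
theorem norm_det_le_norm_det {K L : Matrix m m ℂ} (hK : K.PosDef) (hL : (L - K).PosSemidef) :
    ‖K.det‖ ≤ ‖L.det‖ := by
  obtain ⟨J, -, hJ⟩ := exists_isHermitian_mul_self hK.posSemidef
  obtain ⟨F, -, hF⟩ := exists_isHermitian_mul_self hL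
  have hJu : IsUnit J.det := by
    rw [isUnit_iff_ne_zero]
    intro h0
    have := hK.det_pos.ne'
    rw [hJ, det_mul, h0, mul_zero] at this
    exact this rfl
  have hL' : L = Jᴴ * (1 + (F * J⁻¹)ᴴ * (F * J⁻¹)) * J := by
    have h1 : (F * J⁻¹) * J = F := by
      rw [Matrix.mul_assoc, nonsing_inv_mul J hJu, Matrix.mul_one]
    have h2 : Jᴴ * (F * J⁻¹)ᴴ = Fᴴ := by rw [← conjTranspose_mul, h1]
    rw [Matrix.mul_add, Matrix.add_mul, Matrix.mul_one, ← Matrix.mul_assoc, h2, Matrix.mul_assoc,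
      h1, ← hJ, ← hF]
    abel
  have h1 := one_le_norm_det_one_add (posSemidef_conjTranspose_mul_self (F * J⁻¹))
  rw [hL', hJ, det_mul, det_mul, det_mul]
  simp only [norm_mul]
  nlinarith [norm_nonneg Jᴴ.det, norm_nonneg J.det, mul_nonneg (norm_nonneg Jᴴ.det)
    (norm_nonneg J.det)]

/-- The Cauchy-Schwarz inequality for determinants. -/
theorem norm_det_conjTranspose_mul_sq_le (C D : Matrix ι κ ℂ) :
    ‖(Cᴴ * D).det‖ ^ 2 ≤ ‖(Cᴴ * C).det‖ * ‖(Dᴴ * D).det‖ := by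
  by_cases h0 : (Cᴴ * D).det = 0
  · rw [h0, norm_zero, zero_pow two_ne_zero]
    exact mul_nonneg (norm_nonneg _) (norm_nonneg _)
  have hDC : (Dᴴ * C).det ≠ 0 := by
    have : (Dᴴ * C) = (Cᴴ * D)ᴴ := by simp
    rw [this, det_conjTranspose]
    simpa using h0
  have hC : (Cᴴ * C).PosDef := by
    refine PosDef.conjTranspose_mul_self C fun x y hxy => ?_
    have : (Dᴴ * C) *ᵥ x = (Dᴴ * C) *ᵥ y := by
      simp only [← mulVec_mulVec]
      exact congrArg _ hxy
    exact mulVec_injective_iff_isUnit.2 ((isUnit_iff_isUnit_det _).2 (isUnit_iff_ne_zero.2 hDC))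
      this
  -- The Gram matrix of the columns of C and D is positive; its Schur complement gives
  -- (C*D)*(C*C)⁻¹(C*D) ≤ D*D, and determinants are taken.
  have hblock : (fromBlocks (Cᴴ * C) (Cᴴ * D) (Cᴴ * D)ᴴ (Dᴴ * D)).PosSemidef := by
    have := posSemidef_conjTranspose_mul_self (fromCols C D)
    rwa [conjTranspose_fromCols_eq_fromRows_conjTranspose, fromRows_mul_fromCols,
      show Dᴴ * C = (Cᴴ * D)ᴴ by simp] at this
  have hdet : (Cᴴ * C).det ≠ 0 := hC.det_pos.ne'
  let _ : Invertible (Cᴴ * C) := (Cᴴ * C).invertibleOfIsUnitDet (isUnit_iff_ne_zero.2 hdet)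
  have hS := (PosDef.fromBlocks₁₁ (Cᴴ * D) (Dᴴ * D) hC).1 hblock
  have hpd : ((Cᴴ * D)ᴴ * (Cᴴ * C)⁻¹ * (Cᴴ * D)).PosDef := by
    refine hC.inv.conjTranspose_mul_mul_same ?_
    exact mulVec_injective_iff_isUnit.2 ((isUnit_iff_isUnit_det _).2 (isUnit_iff_ne_zero.2 h0))
  have hle := norm_det_le_norm_det hpd hS
  rw [det_mul, det_mul, det_conjTranspose, det_nonsing_inv, Ring.inverse_eq_inv', norm_mul,
    norm_mul, norm_star, norm_inv] at hle
  have hpos : 0 < ‖(Cᴴ * C).det‖ := norm_pos_iff.2 hdet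
  calc ‖(Cᴴ * D).det‖ ^ 2
      = ‖(Cᴴ * C).det‖ * (‖(Cᴴ * D).det‖ * ‖(Cᴴ * C).det‖⁻¹ * ‖(Cᴴ * D).det‖) := by
        field_simp
    _ ≤ _ := mul_le_mul_of_nonneg_left hle hpos.le

/-- The determinant of a compression is dominated by the corresponding determinant for any
threshold `c`. -/
theorem norm_det_compression_le_pow_mul {U : Matrix m ι ℂ} (hU : IsUnitaryFrame U) {α : ι → ℝ}
    (hα : ∀ i, 0 ≤ α i) {P : Matrix m κ ℂ} (hP : Pᴴ * P = 1) {c : ℝ} (hc : 0 < c)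
    (hdet : (Pᴴ * (U * realDiag α * Uᴴ) * P).det ≠ 0) :
    ‖(Pᴴ * (U * realDiag α * Uᴴ) * P).det‖ ≤
      c ^ Fintype.card κ * ∏ i, max (α i / c) 1 := by
  -- β is the excess of α/c over 1, so α ≤ c(1 + β).
  set β : ι → ℝ := fun i => max (α i / c) 1 - 1
  have hβ : ∀ i, 0 ≤ β i := fun i => sub_nonneg.2 (le_max_right _ _)
  have hβα : ∀ i, 0 ≤ c * (1 + β i) - α i := fun i => by
    have : α i / c ≤ 1 + β i := by
      rw [add_sub_cancel]
      exact le_max_left _ _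
    rw [div_le_iff₀ hc] at this
    linarith
  set K : Matrix m ι ℂ := U * realDiag fun i => Real.sqrt (β i)
  have hKK : K * Kᴴ = U * realDiag β * Uᴴ := by
    simp only [K, conjTranspose_mul, realDiag_conjTranspose]
    rw [← Matrix.mul_assoc, Matrix.mul_assoc U, realDiag_mul_realDiag]
    simp only [Real.mul_self_sqrt (hβ _)]
  have hKK' : Kᴴ * K = realDiag β := by
    simp only [K, conjTranspose_mul, realDiag_conjTranspose]
    rw [Matrix.mul_assoc, ← Matrix.mul_assoc Uᴴ, hU.1, Matrix.one_mul, realDiag_mul_realDiag]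
    simp only [Real.mul_self_sqrt (hβ _)]
  clear_value K
  have hone : realDiag (fun _ : ι => (1 : ℝ)) = 1 := by simp [realDiag]
  have hG := ((posSemidef_conj_realDiag U hα).conjTranspose_mul_mul_same P).posDef_iff_det_ne_zero.2
    hdet
  have h1 : ‖(Pᴴ * (U * realDiag α * Uᴴ) * P).det‖ ≤
      ‖((c : ℂ) • (1 + Pᴴ * K * (Kᴴ * P))).det‖ := by
    refine norm_det_le_norm_det hG ?_
    have : (c : ℂ) • (1 + Pᴴ * K * (Kᴴ * P)) - Pᴴ * (U * realDiag α * Uᴴ) * P =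
        Pᴴ * (U * realDiag (fun i => c * (1 + β i) - α i) * Uᴴ) * P := by
      have e1 : realDiag (fun i => c * (1 + β i) - α i) =
          (c : ℂ) • (1 + realDiag β) - realDiag α := by
        rw [← hone, ← realDiag_add, ← realDiag_smul, eq_sub_iff_add_eq, ← realDiag_add]
        simp
      have e2 : (1 : Matrix κ κ ℂ) + Pᴴ * K * (Kᴴ * P) =
          Pᴴ * (U * (1 + realDiag β) * Uᴴ) * P := by
        rw [Matrix.mul_add U, Matrix.mul_one, Matrix.add_mul, hU.2, ← hKK, Matrix.mul_add,
          Matrix.add_mul, Matrix.mul_one, hP]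
        simp only [Matrix.mul_assoc]
      rw [e1, e2]
      simp only [Matrix.mul_sub, Matrix.sub_mul, Matrix.mul_smul, Matrix.smul_mul]
    rw [this]
    exact (posSemidef_conj_realDiag U hβα).conjTranspose_mul_mul_same P
  -- Swapping the factors by det(1 + RS) = det(1 + SR) puts PP* between K* and K, where PP* ≤ 1
  -- removes it.
  have h2 : ‖(1 + Kᴴ * P * (Pᴴ * K)).det‖ ≤ ‖(1 + Kᴴ * K).det‖ := by
    refine norm_det_le_norm_det ?_ ?_
    · have : (Kᴴ * P * (Pᴴ * K)).PosSemidef := by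
        have := posSemidef_conjTranspose_mul_self (Pᴴ * K)
        rwa [conjTranspose_mul, conjTranspose_conjTranspose] at this
      exact PosDef.one.add_posSemidef this
    · set Q : Matrix m m ℂ := 1 - P * Pᴴ
      have hQh : Qᴴ = Q := by simp [Q]
      have hQQ : Q * Q = Q := by
        have : P * Pᴴ * (P * Pᴴ) = P * Pᴴ := by
          rw [Matrix.mul_assoc, ← Matrix.mul_assoc Pᴴ, hP, Matrix.one_mul]
        simp [Q, Matrix.mul_sub, Matrix.sub_mul, this]
      have : 1 + Kᴴ * K - (1 + Kᴴ * P * (Pᴴ * K)) = (Q * K)ᴴ * (Q * K) := by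
        rw [conjTranspose_mul, hQh, Matrix.mul_assoc Kᴴ Q, ← Matrix.mul_assoc Q, hQQ]
        simp only [Q, Matrix.sub_mul, Matrix.mul_sub, Matrix.one_mul, Matrix.mul_assoc]
        abel
      rw [this]
      exact posSemidef_conjTranspose_mul_self _
  have h3 : ‖(1 + Kᴴ * K).det‖ = ∏ i, max (α i / c) 1 := by
    rw [hKK', ← hone, ← realDiag_add, realDiag, det_diagonal, norm_prod]
    refine Finset.prod_congr rfl fun i _ => ?_
    rw [Complex.norm_real, add_sub_cancel, Real.norm_of_nonneg]
    exact zero_le_one.trans (le_max_right _ _)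
  rw [det_smul, det_one_add_mul_comm, norm_mul, norm_pow, Complex.norm_real,
    Real.norm_of_nonneg hc.le] at h1
  rw [← h3]
  exact h1.trans (mul_le_mul_of_nonneg_left h2 (pow_nonneg hc.le _))

/-- The threshold c is taken at the l-th entry: later factors of the preceding bound become 1, and
c^l cancels the denominators of the first l. Replacing c by max(c, ε) keeps it positive, and ε tends
to 0. -/
theorem norm_det_compression_le {N : ℕ} {U : Matrix m (Fin N) ℂ} (hU : IsUnitaryFrame U)
    {α : Fin N → ℝ} (hα : ∀ i, 0 ≤ α i) (hmono : Antitone α) {l : ℕ} (hl : l ≤ N)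
    {P : Matrix m (Fin l) ℂ} (hP : Pᴴ * P = 1) :
    ‖(Pᴴ * (U * realDiag α * Uᴴ) * P).det‖ ≤ ∏ i : Fin l, α (Fin.castLE hl i) := by
  by_cases hdet : (Pᴴ * (U * realDiag α * Uᴴ) * P).det = 0
  · rw [hdet, norm_zero]
    exact Finset.prod_nonneg fun i _ => hα _
  obtain rfl | ⟨k, rfl⟩ : l = 0 ∨ ∃ k, l = k + 1 := by cases l <;> simp
  · simp
  have key : ∀ ε : ℝ, 0 < ε → ‖(Pᴴ * (U * realDiag α * Uᴴ) * P).det‖ ≤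
      ∏ i : Fin (k + 1), max (α (Fin.castLE hl i)) ε := by
    intro ε hε
    set c := max (α (Fin.castLE hl (Fin.last k))) ε
    have hc : 0 < c := lt_max_of_lt_right hε
    refine (norm_det_compression_le_pow_mul hU hα hP hc hdet).trans (le_of_eq ?_)
    have hsplit : ∏ i, max (α i / c) 1 =
        ∏ i : Fin (k + 1), max (α (Fin.castLE hl i) / c) 1 := by
      refine Eq.trans ?_ (Finset.prod_map Finset.univ (Fin.castLEEmb hl)
        fun i => max (α i / c) 1)
      refine (Finset.prod_subset (Finset.subset_univ _) fun i _ hi => ?_).symm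
      refine max_eq_right ((div_le_one hc).2 (le_max_of_le_left (hmono ?_)))
      by_contra hlt
      refine hi (Finset.mem_map.2 ⟨⟨i, ?_⟩, Finset.mem_univ _, ?_⟩)
      · have := Fin.lt_def.1 (not_le.1 hlt)
        simp at this
        omega
      · ext
        simp
    rw [hsplit, ← Finset.card_univ, ← Finset.prod_const, ← Finset.prod_mul_distrib]
    refine Finset.prod_congr rfl fun i _ => ?_
    have hi : α (Fin.castLE hl (Fin.last k)) ≤ α (Fin.castLE hl i) :=
      hmono (by rw [Fin.le_def]; simpa using Fin.is_le i)
    rw [mul_max_of_nonneg _ _ hc.le, mul_div_cancel₀ _ hc.ne', mul_one]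
    simp only [c]
    rw [← max_assoc, max_eq_left hi]
  have hlim : Filter.Tendsto (fun ε : ℝ => ∏ i : Fin (k + 1), max (α (Fin.castLE hl i)) ε)
      (nhdsWithin 0 (Ioi 0)) (nhds (∏ i : Fin (k + 1), max (α (Fin.castLE hl i)) 0)) := by
    refine Filter.Tendsto.mono_left (Continuous.tendsto ?_ 0) nhdsWithin_le_nhds
    fun_prop
  simp only [max_eq_left (hα _)] at hlim
  exact ge_of_tendsto hlim (eventually_nhdsWithin_of_forall key)

/-- **Horn's inequality**: the singular values `s` of a product `X * Y` are weakly log-majorized by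
the products of the singular values of `X` and `Y`, whose squares are `α` and `β`. -/
theorem prod_sq_le_of_mul {N : ℕ} {X : Matrix m κ ℂ} {Y : Matrix κ m ℂ}
    {U V G H : Matrix m (Fin N) ℂ} {s α β : Fin N → ℝ}
    (hU : IsUnitaryFrame U) (hV : IsUnitaryFrame V) (hG : IsUnitaryFrame G)
    (hH : IsUnitaryFrame H) (hα : ∀ i, 0 ≤ α i) (hβ : ∀ i, 0 ≤ β i)
    (hα_mono : Antitone α) (hβ_mono : Antitone β)
    (hs : X * Y = U * realDiag s * Vᴴ) (hX : X * Xᴴ = G * realDiag α * Gᴴ)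
    (hY : Yᴴ * Y = H * realDiag β * Hᴴ) {l : ℕ} (hl : l ≤ N) :
    ∏ i : Fin l, s (Fin.castLE hl i) ^ 2 ≤
      ∏ i : Fin l, (α (Fin.castLE hl i) * β (Fin.castLE hl i)) := by
  set P := U.submatrix id (Fin.castLE hl)
  set Q := V.submatrix id (Fin.castLE hl)
  have hsub : ∀ {W : Matrix m (Fin N) ℂ}, IsUnitaryFrame W →
      (W.submatrix id (Fin.castLE hl))ᴴ * W.submatrix id (Fin.castLE hl) = 1 := by
    intro W hW
    rw [conjTranspose_submatrix, ← submatrix_mul _ _ _ id _ Function.bijective_id, hW.1,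
      submatrix_one _ (Fin.castLE_injective hl)]
  have hdiag : Pᴴ * (X * Y) * Q = realDiag fun i => s (Fin.castLE hl i) := by
    have h1 : Pᴴ * (X * Y) * Q =
        (Uᴴ * (X * Y) * V).submatrix (Fin.castLE hl) (Fin.castLE hl) := by
      rw [submatrix_mul _ _ _ id _ Function.bijective_id,
        submatrix_mul _ _ _ id _ Function.bijective_id, submatrix_id_id, conjTranspose_submatrix]
    have h2 : Uᴴ * (X * Y) * V = realDiag s := by
      rw [hs]
      calc Uᴴ * (U * realDiag s * Vᴴ) * V = (Uᴴ * U) * realDiag s * (Vᴴ * V) := by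
            simp only [Matrix.mul_assoc]
        _ = _ := by rw [hU.1, hV.1, Matrix.one_mul, Matrix.mul_one]
    rw [h1, h2]
    ext i j
    simp [realDiag, diagonal_apply]
  -- Compressing XY to its first l singular vectors gives the diagonal block of s; Cauchy-Schwarz
  -- separates X from Y.
  have h := norm_det_conjTranspose_mul_sq_le (Xᴴ * P) (Y * Q)
  have e1 : (Xᴴ * P)ᴴ * (Y * Q) = Pᴴ * (X * Y) * Q := by
    simp only [conjTranspose_mul, conjTranspose_conjTranspose, Matrix.mul_assoc]
  have e2 : (Xᴴ * P)ᴴ * (Xᴴ * P) = Pᴴ * (X * Xᴴ) * P := by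
    simp only [conjTranspose_mul, conjTranspose_conjTranspose, Matrix.mul_assoc]
  have e3 : (Y * Q)ᴴ * (Y * Q) = Qᴴ * (Yᴴ * Y) * Q := by
    simp only [conjTranspose_mul, Matrix.mul_assoc]
  rw [e1, e2, e3, hdiag, hX, hY, realDiag, det_diagonal, norm_prod, ← Finset.prod_pow] at h
  simp only [Complex.norm_real, Real.norm_eq_abs, sq_abs] at h
  refine h.trans ?_
  rw [Finset.prod_mul_distrib]
  exact mul_le_mul (norm_det_compression_le hG hα hα_mono hl (hsub hU))
    (norm_det_compression_le hH hβ hβ_mono hl (hsub hV)) (norm_nonneg _)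
    (Finset.prod_nonneg fun i _ => hα _)

end Determinants

/-! ### Scalar inequalities for concave and e-convex functions. -/

section ScalarFunctions

/-- The right derivative is a monotone choice of subgradient; monotonicity is what makes the weights
antitone in the later summation by parts. -/
theorem ConvexOn.exists_monotone_subgradient {φ : ℝ → ℝ} (hφ : ConvexOn ℝ univ φ) :
    ∃ c : ℝ → ℝ, Monotone c ∧ ∀ x y, φ x + c x * (y - x) ≤ φ y := by
  refine ⟨fun x => derivWithin φ (Ioi x) x, fun x y hxy => ?_, fun x y => ?_⟩
  · exact hφ.monotoneOn_rightDeriv (by simp) (by simp) hxy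
  · rcases lt_trichotomy x y with h | rfl | h
    · have := hφ.rightDeriv_le_slope_of_mem_interior (x := x) (by simp) (mem_univ y) h
      rw [slope_def_field, le_div_iff₀ (sub_pos.2 h)] at this
      linarith
    · simp
    · have h1 := hφ.slope_le_leftDeriv_of_mem_interior (y := x) (mem_univ y) (by simp) h
      have h2 := hφ.leftDeriv_le_rightDeriv_of_mem_interior (x := x) (by simp)
      have := h1.trans h2
      rw [slope_def_field, div_le_iff₀ (sub_pos.2 h)] at this
      linarith

variable {f : ℝ → ℝ}

theorem ConcaveOn.monotoneOn_of_nonneg (hf : ConcaveOn ℝ (Ici 0) f)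
    (hf0 : MapsTo f (Ici 0) (Ici 0)) : MonotoneOn f (Ici 0) := by
  intro x hx y hy hxy
  rcases hxy.eq_or_lt with rfl | hlt
  · rfl
  by_contra! hfy
  set μ := (f y - f x) / (y - x)
  have hμ : μ < 0 := div_neg_of_neg_of_pos (sub_neg.2 hfy) (sub_pos.2 hlt)
  have hy0 : 0 ≤ f y := hf0 hy
  have ht : 0 < (f y + 1) / (-μ) := div_pos (by linarith) (neg_pos.2 hμ)
  -- Extending the descending chord beyond y, the line reaches height -1 at z, so concavity forces f
  -- z < 0.
  set z := y + (f y + 1) / (-μ)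
  have hz : z ∈ Ici (0 : ℝ) := by
    have : 0 ≤ y := hy
    simp only [mem_Ici, z]
    linarith
  have hs := hf.slope_anti_adjacent hx hz hlt (by simpa [z] using ht)
  rw [div_le_iff₀ (by simpa [z] using ht)] at hs
  have hz0 : 0 ≤ f z := hf0 hz
  have : μ * (z - y) = -(f y + 1) := by
    simp only [z, add_sub_cancel_left]
    rw [div_neg, mul_neg, mul_div_cancel₀ _ hμ.ne]
  change f z - f y ≤ μ * (z - y) at hs
  linarith

theorem ConcaveOn.exists_nonneg_supergradient (hf : ConcaveOn ℝ (Ici 0) f)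
    (hf0 : MapsTo f (Ici 0) (Ici 0)) {a : ℝ} (ha : 0 < a) :
    ∃ c, 0 ≤ c ∧ ∀ t, 0 ≤ t → f t ≤ f a + c * (t - a) := by
  have hint : a ∈ interior (Ici (0 : ℝ)) := by simpa using ha
  have hneg := hf.neg
  set c := derivWithin (-f) (Ioi a) a
  have key : ∀ t, 0 ≤ t → f t ≤ f a + -c * (t - a) := by
    intro t ht
    rcases lt_trichotomy a t with h | rfl | h
    · have := hneg.rightDeriv_le_slope_of_mem_interior hint ht h
      rw [slope_def_field, le_div_iff₀ (sub_pos.2 h)] at this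
      simp only [Pi.neg_apply] at this
      linarith
    · simp
    · have h1 := hneg.slope_le_leftDeriv_of_mem_interior ht hint h
      have := h1.trans (hneg.leftDeriv_le_rightDeriv_of_mem_interior hint)
      rw [slope_def_field, div_le_iff₀ (sub_pos.2 h)] at this
      simp only [Pi.neg_apply] at this
      linarith
  refine ⟨-c, ?_, key⟩
  have h1 := key (a + 1) (by linarith)
  have h2 := hf.monotoneOn_of_nonneg hf0 (a := a) ha.le (b := a + 1)
    (by simp only [mem_Ici]; linarith) (by linarith)
  linarith

/-- Taking logarithms turns products into sums. Subgradients of t ↦ f(exp t) at log s_i are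
nonnegative antitone weights, so summation by parts compares f(s_i) with f(√(α_iβ_i)), and midpoint
convexity finishes. -/
theorem EConvex.sum_le_of_prod_le_of_pos (hf : EConvex f) (hmono : MonotoneOn f (Ici 0)) {k : ℕ}
    {s α β : Fin k → ℝ} (hpos : ∀ i, 0 < s i) (hα : ∀ i, 0 ≤ α i) (hβ : ∀ i, 0 ≤ β i)
    (hanti : Antitone s)
    (hprod : ∀ (l : ℕ) (hl : l ≤ k), ∏ i : Fin l, s (Fin.castLE hl i) ^ 2 ≤
      ∏ i : Fin l, (α (Fin.castLE hl i) * β (Fin.castLE hl i))) :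
    ∑ i, f (s i) ≤ ∑ i, (f (α i) + f (β i)) / 2 := by
  have hαβ : ∀ i, α i * β i ≠ 0 := by
    have h1 := hprod k le_rfl
    simp only [Fin.castLE_rfl, id] at h1
    have h2 : 0 < ∏ i, s i ^ 2 := Finset.prod_pos fun i _ => pow_pos (hpos i) 2
    exact fun i => Finset.prod_ne_zero_iff.1 (h2.trans_le h1).ne' i (Finset.mem_univ i)
  have hα' : ∀ i, 0 < α i := fun i => (hα i).lt_of_ne' (left_ne_zero_of_mul (hαβ i))
  have hβ' : ∀ i, 0 < β i := fun i => (hβ i).lt_of_ne' (right_ne_zero_of_mul (hαβ i))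
  obtain ⟨c, hc, hsub⟩ := ConvexOn.exists_monotone_subgradient hf
  have hc0 : ∀ t, 0 ≤ c t := fun t => by
    have h1 := hsub t (t - 1)
    have h2 := hmono (Real.exp_pos (t - 1)).le (Real.exp_pos t).le
      (Real.exp_le_exp.2 (by linarith))
    linarith
  have hmid : ∀ i, f (Real.exp ((Real.log (α i) + Real.log (β i)) / 2)) ≤
      (f (α i) + f (β i)) / 2 := fun i => by
    have h := And.right hf (mem_univ (Real.log (α i))) (mem_univ (Real.log (β i)))
      (by norm_num : (0 : ℝ) ≤ 1 / 2) (by norm_num : (0 : ℝ) ≤ 1 / 2) (by norm_num)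
    simp only [smul_eq_mul, Real.exp_log (hα' i), Real.exp_log (hβ' i)] at h
    have e : (Real.log (α i) + Real.log (β i)) / 2 =
      1 / 2 * Real.log (α i) + 1 / 2 * Real.log (β i) := by ring
    rw [e]
    linarith
  have habel := sum_mul_nonneg_of_antitone (w := fun i => c (Real.log (s i)))
    (d := fun i => (Real.log (α i) + Real.log (β i)) / 2 - Real.log (s i))
    (fun i j hij => hc (Real.log_le_log (hpos j) (hanti hij))) (fun i => hc0 _)
    fun l hl => by
      have h1 := Real.log_le_log (Finset.prod_pos fun i _ => pow_pos (hpos _) 2) (hprod l hl)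
      rw [Real.log_prod (fun i _ => (pow_pos (hpos _) 2).ne'),
        Real.log_prod (fun i _ => hαβ _)] at h1
      have h2 : ∑ i : Fin l, ((Real.log (α (Fin.castLE hl i)) + Real.log (β (Fin.castLE hl i))) / 2
          - Real.log (s (Fin.castLE hl i))) =
          (∑ i : Fin l, Real.log (α (Fin.castLE hl i) * β (Fin.castLE hl i)) -
            ∑ i : Fin l, Real.log (s (Fin.castLE hl i) ^ 2)) / 2 := by
        rw [← Finset.sum_sub_distrib, Finset.sum_div]
        refine Finset.sum_congr rfl fun i _ => ?_
        rw [Real.log_mul (hα' _).ne' (hβ' _).ne', Real.log_pow]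
        push_cast
        ring
      rw [h2]
      linarith
  have hsum : ∑ i, c (Real.log (s i)) *
      ((Real.log (α i) + Real.log (β i)) / 2 - Real.log (s i)) ≤
      ∑ i, ((f (α i) + f (β i)) / 2 - f (s i)) := by
    refine Finset.sum_le_sum fun i _ => ?_
    have h1 := hsub (Real.log (s i)) ((Real.log (α i) + Real.log (β i)) / 2)
    simp only [Real.exp_log (hpos i)] at h1
    linarith [hmid i]
  rw [Finset.sum_sub_distrib] at hsum
  linarith

/-- Weak log-majorization is turned into weak majorization by monotone e-convex functions. -/
theorem EConvex.sum_le_of_prod_le (hf : EConvex f) (hmono : MonotoneOn f (Ici 0)) {k : ℕ}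
    {s α β : Fin k → ℝ} (hs : ∀ i, 0 ≤ s i) (hα : ∀ i, 0 ≤ α i) (hβ : ∀ i, 0 ≤ β i)
    (hanti : Antitone s)
    (hprod : ∀ (l : ℕ) (hl : l ≤ k), ∏ i : Fin l, s (Fin.castLE hl i) ^ 2 ≤
      ∏ i : Fin l, (α (Fin.castLE hl i) * β (Fin.castLE hl i))) :
    ∑ i, f (s i) ≤ ∑ i, (f (α i) + f (β i)) / 2 := by
  induction k with
  | zero => simp
  | succ k ih =>
    -- A zero last entry contributes f 0, the least value of f, and can be split off; otherwise
    -- every entry is positive.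
    by_cases hlast : s (Fin.last k) = 0
    · have hf0 : ∀ t, 0 ≤ t → f 0 ≤ f t := fun t ht =>
        hmono (mem_Ici.2 le_rfl) (mem_Ici.2 ht) ht
      rw [Fin.sum_univ_castSucc, Fin.sum_univ_castSucc]
      refine add_le_add ?_ ?_
      · exact ih (fun i => hs _) (fun i => hα _) (fun i => hβ _)
          (fun i j hij => hanti (Fin.castSucc_le_castSucc_iff.2 hij))
          fun l hl => hprod l (hl.trans k.le_succ)
      · rw [hlast]
        linarith [hf0 _ (hα (Fin.last k)), hf0 _ (hβ (Fin.last k))]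
    · exact hf.sum_le_of_prod_le_of_pos hmono
        (fun i => ((hs _).lt_of_ne' hlast).trans_le (hanti (Fin.le_last i))) hα hβ hanti hprod

theorem sum_castLE_eq {N k : ℕ} (hk : k ≤ N) (g : Fin N → ℝ) :
    ∑ i : Fin k, g (Fin.castLE hk i) =
      ∑ j ∈ Finset.univ.filter fun j : Fin N => (j : ℕ) < k, g j := by
  refine (Finset.sum_map Finset.univ (Fin.castLEEmb hk) g).symm.trans
    (Finset.sum_congr ?_ fun _ _ => rfl)
  ext j
  simp only [Finset.mem_map, Finset.mem_univ, true_and, Finset.mem_filter]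
  constructor
  · rintro ⟨i, rfl⟩
    simp
  · intro hj
    exact ⟨⟨j, hj⟩, by ext; simp⟩

/-- This is subadditivity for a single eigenvalue `a` of A, with S = diag(s) ≥ A and w_j the squared
coordinates of its eigenvector; `hquad` is the rank-one bound a vv* ≤ S. A tangent line at `a`
reduces it to the initial sums of g_j = w_j(1 - a/s_j). -/
theorem ConcaveOn.weighted_sum_le (hf : ConcaveOn ℝ (Ici 0) f)
    (hf0 : MapsTo f (Ici 0) (Ici 0)) {N : ℕ} {s w : Fin N → ℝ} (hs : ∀ i, 0 ≤ s i)
    (hanti : Antitone s) (hw : ∀ i, 0 ≤ w i) (hw1 : ∑ i, w i = 1) {a : ℝ} (ha : 0 ≤ a)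
    (hquad : ∀ t : Fin N → ℝ, a * (∑ i, w i * t i) ^ 2 ≤ ∑ i, s i * (w i * t i ^ 2))
    {k : ℕ} (hk : k ≤ N) :
    ∑ i : Fin k, (f (s (Fin.castLE hk i)) - f 0) / s (Fin.castLE hk i) *
        (a * w (Fin.castLE hk i)) ≤
      ∑ i : Fin k, (f a - f 0) * w (Fin.castLE hk i) := by
  rcases ha.eq_or_lt with rfl | ha
  · simp
  obtain ⟨c, hc, htan⟩ := hf.exists_nonneg_supergradient hf0 ha
  have hB : 0 ≤ f a - f 0 - c * a := by linarith [htan 0 le_rfl]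
  -- Thus the convention x / 0 = 0 is harmless: all terms with s_j = 0 vanish.
  have hker : ∀ j, s j = 0 → w j = 0 := fun j hj => by
    have h := hquad (Pi.single j 1)
    simp only [Pi.single_apply, mul_ite, mul_one, mul_zero, Finset.sum_ite_eq', Finset.mem_univ,
      if_true, ite_pow, one_pow, ne_eq, OfNat.ofNat_ne_zero, not_false_eq_true, zero_pow, hj,
      zero_mul] at h
    have : w j ^ 2 ≤ 0 := by nlinarith [sq_nonneg (w j)]
    exact pow_eq_zero_iff two_ne_zero |>.1 (le_antisymm this (sq_nonneg _))
  set g : Fin N → ℝ := fun j => w j - a * (w j / s j)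
  have hall : 0 ≤ ∑ j, g j := by
    -- With t = 1/s and X = ∑ w_j/s_j the bound reads aX² ≤ X, whence aX ≤ 1.
    have h := hquad fun j => (s j)⁻¹
    have e : ∑ i, s i * (w i * (s i)⁻¹ ^ 2) = ∑ i, w i * (s i)⁻¹ := by
      refine Finset.sum_congr rfl fun i _ => ?_
      by_cases hi : s i = 0
      · simp [hi]
      · field_simp
    rw [e] at h
    have hX : 0 ≤ ∑ i, w i * (s i)⁻¹ :=
      Finset.sum_nonneg fun i _ => mul_nonneg (hw i) (inv_nonneg.2 (hs i))
    simp only [g, Finset.sum_sub_distrib, hw1, ← Finset.mul_sum, div_eq_mul_inv]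
    rcases hX.eq_or_lt with h0 | hpos
    · rw [← h0]
      simp
    · nlinarith
  -- As s decreases, g changes sign at most once, from nonnegative to nonpositive, so its initial
  -- sums inherit nonnegativity from the full sum.
  have htop : 0 ≤ ∑ i : Fin k, g (Fin.castLE hk i) := by
    by_cases hg : ∀ i : Fin k, 0 ≤ g (Fin.castLE hk i)
    · exact Finset.sum_nonneg fun i _ => hg i
    push Not at hg
    obtain ⟨i₀, hi₀⟩ := hg
    refine hall.trans ?_
    rw [sum_castLE_eq hk g, ← Finset.sum_filter_add_sum_filter_not Finset.univ
      (fun j : Fin N => (j : ℕ) < k) g]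
    refine add_le_of_nonpos_right (Finset.sum_nonpos (f := g) fun j hj => ?_)
    have hs0 : 0 < s (Fin.castLE hk i₀) := by
      refine (hs _).lt_of_ne' fun h0 => ?_
      simp [g, hker _ h0] at hi₀
    have hlt : s (Fin.castLE hk i₀) < a := by
      by_contra! hle
      have : a * (w (Fin.castLE hk i₀) / s (Fin.castLE hk i₀)) ≤ w (Fin.castLE hk i₀) := by
        rw [← mul_div_assoc, div_le_iff₀ hs0, mul_comm]
        exact mul_le_mul_of_nonneg_left hle (hw _)
      simp only [g] at hi₀
      linarith
    have hj' : k ≤ (j : ℕ) := by simpa using hj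
    have hsj : s j ≤ s (Fin.castLE hk i₀) := hanti (by
      rw [Fin.le_def]
      simpa using i₀.2.le.trans hj')
    by_cases hsj0 : s j = 0
    · simp [g, hker j hsj0]
    · have hsjp : 0 < s j := (hs j).lt_of_ne' hsj0
      have : w j ≤ a * (w j / s j) := by
        rw [← mul_div_assoc, le_div_iff₀ hsjp, mul_comm]
        exact mul_le_mul_of_nonneg_right (hsj.trans hlt.le) (hw j)
      simp only [g]
      linarith
  have hterm : ∀ j, (f (s j) - f 0) / s j * (a * w j) ≤
      (f a - f 0) * w j - (f a - f 0 - c * a) * g j := fun j => by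
    by_cases hsj0 : s j = 0
    · simp [g, hker j hsj0]
    · have hsjp : 0 < s j := (hs j).lt_of_ne' hsj0
      have h1 : (f (s j) - f 0) / s j ≤ (f a - f 0 - c * a) / s j + c := by
        rw [div_add' _ _ _ hsj0]
        refine div_le_div_of_nonneg_right ?_ hsjp.le
        linarith [htan (s j) hsjp.le]
      calc _ ≤ ((f a - f 0 - c * a) / s j + c) * (a * w j) :=
            mul_le_mul_of_nonneg_right h1 (mul_nonneg ha.le (hw j))
        _ = _ := by
          simp only [g]
          field_simp
          ring
  refine (Finset.sum_le_sum fun i _ => hterm _).trans ?_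
  rw [Finset.sum_sub_distrib, ← Finset.mul_sum _ _ (f a - f 0 - c * a)]
  linarith [mul_nonneg hB htop]

end ScalarFunctions

/-! ### Ky Fan's maximum principle and subadditivity for concave functions. -/

section TraceInequalities

open Matrix
open scoped ComplexOrder

set_option linter.unusedSectionVars false

variable {m ι κ : Type*} [Fintype m] [DecidableEq m] [Fintype ι] [DecidableEq ι]
  [Fintype κ] [DecidableEq κ]

theorem conjTranspose_mul_realDiag_mul_apply_self (C : Matrix ι κ ℂ) (d : ι → ℝ) (j : κ) :
    (Cᴴ * realDiag d * C) j j = ((∑ i, d i * ‖C i j‖ ^ 2 : ℝ) : ℂ) := by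
  rw [Matrix.mul_apply]
  push_cast
  refine Finset.sum_congr rfl fun i _ => ?_
  rw [realDiag, mul_diagonal, conjTranspose_apply, RCLike.star_def, ← Complex.conj_mul']
  ring

theorem conjTranspose_mul_conj_mul_re (E : Matrix m κ ℂ) (V : Matrix m ι ℂ) (d : ι → ℝ) (j : κ) :
    ((Eᴴ * (V * realDiag d * Vᴴ) * E) j j).re = ∑ i, d i * ‖(Vᴴ * E) i j‖ ^ 2 := by
  have : Eᴴ * (V * realDiag d * Vᴴ) * E = (Vᴴ * E)ᴴ * realDiag d * (Vᴴ * E) := by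
    simp only [conjTranspose_mul, conjTranspose_conjTranspose, Matrix.mul_assoc]
  rw [this, conjTranspose_mul_realDiag_mul_apply_self, Complex.ofReal_re]

theorem dotProduct_conjTranspose_mul_realDiag_mul (C : Matrix ι κ ℂ) (d : ι → ℝ) (y : κ → ℂ) :
    star y ⬝ᵥ ((Cᴴ * realDiag d * C) *ᵥ y) = ((∑ i, d i * ‖(C *ᵥ y) i‖ ^ 2 : ℝ) : ℂ) := by
  rw [← mulVec_mulVec, ← mulVec_mulVec, dotProduct_mulVec, ← star_mulVec, dotProduct]
  push_cast
  refine Finset.sum_congr rfl fun i _ => ?_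
  rw [realDiag, mulVec_diagonal, Pi.star_apply, RCLike.star_def, ← Complex.conj_mul']
  ring

theorem sum_norm_sq_col {C : Matrix ι κ ℂ} (hC : Cᴴ * C = 1) (j : κ) : ∑ i, ‖C i j‖ ^ 2 = 1 := by
  have h := congrFun (congrFun hC j) j
  rw [Matrix.mul_apply, one_apply_eq] at h
  simp only [conjTranspose_apply, RCLike.star_def, Complex.conj_mul'] at h
  exact_mod_cast h

theorem sum_norm_sq_row {C : Matrix ι κ ℂ} (hC : C * Cᴴ = 1) (i : ι) : ∑ j, ‖C i j‖ ^ 2 = 1 := by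
  have := sum_norm_sq_col (C := Cᴴ) (by rwa [conjTranspose_conjTranspose]) i
  simpa using this

/-- **Ky Fan's maximum principle**. -/
theorem sum_diag_le_sum_eigenvalues {N : ℕ} {V E : Matrix m (Fin N) ℂ} (hV : IsUnitaryFrame V)
    (hE : IsUnitaryFrame E) {c : Fin N → ℝ} (hc : Antitone c) {k : ℕ} (hk : k ≤ N) :
    ∑ j : Fin k, ((Eᴴ * (V * realDiag c * Vᴴ) * E) (Fin.castLE hk j) (Fin.castLE hk j)).re ≤
      ∑ j : Fin k, c (Fin.castLE hk j) := by
  have hC := hV.conjTranspose.mul hE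
  set C := Vᴴ * E
  simp only [conjTranspose_mul_conj_mul_re]
  rw [Finset.sum_comm]
  simp only [← Finset.mul_sum]
  obtain rfl | ⟨l, rfl⟩ : k = 0 ∨ ∃ l, k = l + 1 := by cases k <;> simp
  · simp
  set w : Fin N → ℝ := fun i => ∑ j : Fin (l + 1), ‖C i (Fin.castLE hk j)‖ ^ 2
  have hw0 : ∀ i, 0 ≤ w i := fun i => Finset.sum_nonneg fun j _ => sq_nonneg _
  have hw1 : ∀ i, w i ≤ 1 := fun i => by
    rw [← sum_norm_sq_row hC.2 i]
    simp only [w]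
    rw [sum_castLE_eq hk fun j => ‖C i j‖ ^ 2]
    exact Finset.sum_le_sum_of_subset_of_nonneg (Finset.filter_subset _ _)
      fun j _ _ => sq_nonneg _
  have hw : ∑ i, w i = l + 1 := by
    simp only [w]
    rw [Finset.sum_comm]
    simp [sum_norm_sq_col hC.1]
  -- The weights w lie in [0, 1] with total l + 1. Subtracting the last retained eigenvalue γ makes
  -- c_i - γ nonnegative on the first l + 1 indices and nonpositive after, so w may be replaced by
  -- the indicator of those indices.
  set γ := c (Fin.castLE hk (Fin.last l))
  have hterm : ∀ i : Fin N, (c i - γ) * w i ≤ if (i : ℕ) < l + 1 then c i - γ else 0 := fun i => by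
    split_ifs with hi
    · have : γ ≤ c i := hc (by rw [Fin.le_def]; simpa using Nat.lt_succ_iff.1 hi)
      nlinarith [hw1 i]
    · have : c i ≤ γ := hc (by rw [Fin.le_def]; simp; omega)
      nlinarith [hw0 i]
  have hsum := Finset.sum_le_sum fun i (_ : i ∈ Finset.univ) => hterm i
  rw [← Finset.sum_filter, ← sum_castLE_eq hk fun i => c i - γ, Finset.sum_sub_distrib] at hsum
  simp only [sub_mul, Finset.sum_sub_distrib, ← Finset.mul_sum, hw, Finset.sum_const,
    Finset.card_univ, Fintype.card_fin, nsmul_eq_mul] at hsum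
  push_cast at hsum
  linarith

/-- A comparison over the top eigenvectors `E` of `S`, for `0 ≤ A ≤ S` and a concave function. -/
theorem sum_slope_mul_diag_le {f : ℝ → ℝ} (hf : ConcaveOn ℝ (Ici 0) f)
    (hf0 : MapsTo f (Ici 0) (Ici 0)) {N : ℕ} {E : Matrix m (Fin N) ℂ} (hE : IsUnitaryFrame E)
    {s : Fin N → ℝ} (hs : ∀ i, 0 ≤ s i) (hanti : Antitone s) {A : Matrix m m ℂ}
    (hA : A.PosSemidef) (hSA : (E * realDiag s * Eᴴ - A).PosSemidef) {k : ℕ} (hk : k ≤ N) :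
    ∑ j : Fin k, (f (s (Fin.castLE hk j)) - f 0) / s (Fin.castLE hk j) *
        ((Eᴴ * A * E) (Fin.castLE hk j) (Fin.castLE hk j)).re ≤
      ∑ j : Fin k, (((Eᴴ * cfc f A * E) (Fin.castLE hk j) (Fin.castLE hk j)).re - f 0) := by
  obtain ⟨V, hV, hVA⟩ := exists_conj_realDiag hA.1
  have ha := hA.eigenvalues_nonneg
  set a := hA.1.eigenvalues
  clear_value a
  subst hVA
  rw [cfc_conj_realDiag hV]
  have hC := hV.conjTranspose.mul hE
  simp only [conjTranspose_mul_conj_mul_re]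
  have hps : (1ᴴ * realDiag s * 1 - (Vᴴ * E)ᴴ * realDiag a * (Vᴴ * E)).PosSemidef := by
    have := hSA.conjTranspose_mul_mul_same E
    rw [Matrix.mul_sub, Matrix.sub_mul] at this
    have e1 : Eᴴ * (E * realDiag s * Eᴴ) * E = 1ᴴ * realDiag s * 1 := by
      calc Eᴴ * (E * realDiag s * Eᴴ) * E = (Eᴴ * E) * realDiag s * (Eᴴ * E) := by
            simp only [Matrix.mul_assoc]
        _ = _ := by rw [hE.1, conjTranspose_one]
    have e2 : Eᴴ * (V * realDiag a * Vᴴ) * E = (Vᴴ * E)ᴴ * realDiag a * (Vᴴ * E) := by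
      simp only [conjTranspose_mul, conjTranspose_conjTranspose, Matrix.mul_assoc]
    rwa [e1, e2] at this
  set C := Vᴴ * E
  have hquad : ∀ i, ∀ t : Fin N → ℝ, a i * (∑ j, ‖C i j‖ ^ 2 * t j) ^ 2 ≤
      ∑ j, s j * (‖C i j‖ ^ 2 * t j ^ 2) := by
    intro i t
    -- This test vector turns (Cy)_i into ∑ |C_ij|² t_j; the other terms of the quadratic form are
    -- nonnegative and are dropped.
    set y : Fin N → ℂ := fun j => (starRingEnd ℂ (C i j)) * t j
    have h := hps.re_dotProduct_nonneg y
    rw [sub_mulVec, dotProduct_sub, dotProduct_conjTranspose_mul_realDiag_mul,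
      dotProduct_conjTranspose_mul_realDiag_mul, ← Complex.ofReal_sub] at h
    simp only [RCLike.re_to_complex, Complex.ofReal_re, one_mulVec] at h
    have h1 : (C *ᵥ y) i = ((∑ j, ‖C i j‖ ^ 2 * t j : ℝ) : ℂ) := by
      rw [mulVec, dotProduct]
      push_cast
      refine Finset.sum_congr rfl fun j _ => ?_
      rw [← Complex.mul_conj']
      ring
    have h2 : a i * ‖(C *ᵥ y) i‖ ^ 2 ≤ ∑ i, a i * ‖(C *ᵥ y) i‖ ^ 2 :=
      Finset.single_le_sum (f := fun i => a i * ‖(C *ᵥ y) i‖ ^ 2)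
        (fun i _ => mul_nonneg (ha i) (sq_nonneg _)) (Finset.mem_univ i)
    rw [h1, Complex.norm_real, Real.norm_eq_abs, sq_abs] at h2
    have h3 : ∀ j, ‖y j‖ ^ 2 = ‖C i j‖ ^ 2 * t j ^ 2 := fun j => by
      simp [y, mul_pow]
    simp only [h3] at h
    linarith
  have hmain := Finset.sum_le_sum fun i (_ : i ∈ Finset.univ) =>
    hf.weighted_sum_le hf0 hs hanti (w := fun j => ‖C i j‖ ^ 2) (fun j => sq_nonneg _)
      (sum_norm_sq_row hC.2 i) (ha i) (hquad i) hk
  rw [Finset.sum_comm, Finset.sum_comm (t := (Finset.univ : Finset (Fin k)))] at hmain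
  simp only [← Finset.mul_sum] at hmain
  refine hmain.trans (le_of_eq (Finset.sum_congr rfl fun j _ => ?_))
  simp only [sub_mul, Finset.sum_sub_distrib, ← Finset.mul_sum, sum_norm_sq_col hC.1, mul_one]

/-- Subadditivity of a concave function in terms of the top eigenvectors `E` of `A + B`. -/
theorem sum_concave_add_le {f : ℝ → ℝ} (hf : ConcaveOn ℝ (Ici 0) f)
    (hf0 : MapsTo f (Ici 0) (Ici 0)) {N : ℕ} {E : Matrix m (Fin N) ℂ} (hE : IsUnitaryFrame E)
    {s : Fin N → ℝ} (hs : ∀ i, 0 ≤ s i) (hanti : Antitone s) {A B : Matrix m m ℂ}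
    (hA : A.PosSemidef) (hB : B.PosSemidef) (hAB : A + B = E * realDiag s * Eᴴ)
    {k : ℕ} (hk : k ≤ N) :
    ∑ j : Fin k, f (s (Fin.castLE hk j)) ≤
      ∑ j : Fin k, (((Eᴴ * (cfc f A + cfc f B) * E) (Fin.castLE hk j) (Fin.castLE hk j)).re -
        f 0) := by
  have h1 := sum_slope_mul_diag_le hf hf0 hE hs hanti hA
    (by rwa [← hAB, add_sub_cancel_left]) hk
  have h2 := sum_slope_mul_diag_le hf hf0 hE hs hanti hB
    (by rwa [← hAB, add_sub_cancel_right]) hk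
  have h3 := add_le_add h1 h2
  rw [← Finset.sum_add_distrib, ← Finset.sum_add_distrib] at h3
  have hdiag : ∀ j, ((Eᴴ * A * E) j j).re + ((Eᴴ * B * E) j j).re = s j := fun j => by
    rw [← Complex.add_re, ← Matrix.add_apply, ← Matrix.add_mul, ← Matrix.mul_add, hAB]
    have : Eᴴ * (E * realDiag s * Eᴴ) * E = realDiag s := by
      calc Eᴴ * (E * realDiag s * Eᴴ) * E = (Eᴴ * E) * realDiag s * (Eᴴ * E) := by
            simp only [Matrix.mul_assoc]
        _ = _ := by rw [hE.1, Matrix.one_mul, Matrix.mul_one]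
    rw [this]
    simp [realDiag]
  simp only [← mul_add, hdiag] at h3
  -- The diagonals of E*AE and E*BE add up to s_j, so the two slope bounds recombine into f(s_j) -
  -- f(0).
  have h4 : ∀ j, f (s j) - f 0 = (f (s j) - f 0) / s j * s j := fun j => by
    by_cases hj : s j = 0
    · simp [hj]
    · field_simp
  have h5 : ∑ j : Fin k, (f (s (Fin.castLE hk j)) - f 0) ≤
      ∑ j : Fin k, (((Eᴴ * cfc f A * E) (Fin.castLE hk j) (Fin.castLE hk j)).re - f 0 +
        (((Eᴴ * cfc f B * E) (Fin.castLE hk j) (Fin.castLE hk j)).re - f 0)) := by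
    refine le_trans (le_of_eq (Finset.sum_congr rfl fun j _ => h4 _)) h3
  have h6 := add_le_add_left h5 (∑ j : Fin k, f 0)
  rw [← Finset.sum_add_distrib, ← Finset.sum_add_distrib] at h6
  refine le_trans (le_of_eq (Finset.sum_congr rfl fun j _ => ?_))
    (h6.trans (le_of_eq (Finset.sum_congr rfl fun j _ => ?_)))
  · ring
  · rw [Matrix.mul_add, Matrix.add_mul, Matrix.add_apply, Complex.add_re]
    ring

end TraceInequalities

/-! ### Symmetric norms of block matrices and of products. -/

section SymmetricNorms

open Matrix
open scoped ComplexOrder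

set_option linter.unusedSectionVars false

variable {m n κ : Type*} [Fintype m] [DecidableEq m] [Fintype n] [DecidableEq n]
  [Fintype κ] [DecidableEq κ]

theorem IsSymmetricNorm.mul_conjTranspose_self {p : Seminorm ℂ (Matrix m m ℂ)}
    (hp : IsSymmetricNorm p) (Z : Matrix m m ℂ) : p (Z * Zᴴ) = p (Zᴴ * Z) := by
  obtain ⟨U, V, s, hU, hV, -, hZ⟩ := exists_svd Z
  have h1 : Z * Zᴴ = U * (realDiag s * realDiag s) * Uᴴ := by
    rw [hZ]
    simp only [conjTranspose_mul, conjTranspose_conjTranspose, realDiag_conjTranspose]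
    calc _ = U * realDiag s * (Vᴴ * V) * realDiag s * Uᴴ := by simp only [Matrix.mul_assoc]
      _ = _ := by rw [hV.1]; simp only [Matrix.mul_assoc, Matrix.one_mul]
  have h2 : Zᴴ * Z = V * (realDiag s * realDiag s) * Vᴴ := by
    rw [hZ]
    simp only [conjTranspose_mul, conjTranspose_conjTranspose, realDiag_conjTranspose]
    calc _ = V * realDiag s * (Uᴴ * U) * realDiag s * Vᴴ := by simp only [Matrix.mul_assoc]
      _ = _ := by rw [hU.1]; simp only [Matrix.mul_assoc, Matrix.one_mul]
  rw [h1, h2, hp.frame_eq hU hU hV hV]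

/-- A direct sum of positive semidefinite matrices is dominated by their sum. -/
theorem IsSymmetricNorm.fromBlocks_le_padNorm {p : Seminorm ℂ (Matrix (n ⊕ n) (n ⊕ n) ℂ)}
    (hp : IsSymmetricNorm p) {P Q : Matrix n n ℂ} (hP : P.PosSemidef) (hQ : Q.PosSemidef) :
    p (fromBlocks P 0 0 Q) ≤ padNorm p (P + Q) := by
  obtain ⟨K, hK, hPK⟩ := exists_isHermitian_mul_self hP
  obtain ⟨L, hL, hQL⟩ := exists_isHermitian_mul_self hQ
  set Z : Matrix (n ⊕ n) (n ⊕ n) ℂ := fromBlocks K 0 L 0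
  set J : Matrix (n ⊕ n) (n ⊕ n) ℂ := fromBlocks 1 0 0 (-1)
  have hJ : J ∈ unitaryGroup (n ⊕ n) ℂ := by
    rw [mem_unitaryGroup_iff, star_eq_conjTranspose]
    simp [J, fromBlocks_conjTranspose, fromBlocks_multiply]
  have h1 : Zᴴ * Z = fromBlocks (P + Q) 0 0 0 := by
    simp [Z, fromBlocks_conjTranspose, fromBlocks_multiply, hPK, hQL]
  -- Averaging ZZ* with its conjugate by J = 1 ⊕ (-1) erases the off-diagonal blocks, leaving P ⊕ Q,
  -- while Z*Z = (P + Q) ⊕ 0.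
  have h2 : fromBlocks P 0 0 Q = (1 / 2 : ℂ) • (Z * Zᴴ) + (1 / 2 : ℂ) • (J * (Z * Zᴴ) * J) := by
    rw [hK] at hPK
    rw [hL] at hQL
    rw [← smul_add]
    simp only [Z, J, fromBlocks_conjTranspose, fromBlocks_multiply, fromBlocks_add,
      fromBlocks_smul, hK, hL, ← hPK, ← hQL]
    congr 1 <;> simp [← two_smul ℂ, smul_smul]
  have h3 : p (J * (Z * Zᴴ) * J) = p (Z * Zᴴ) := hp.unitary_invariant J hJ J hJ _
  rw [padNorm, ← h1, ← hp.mul_conjTranspose_self, h2]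
  refine (map_add_le_add p _ _).trans (le_of_eq ?_)
  rw [map_smul_eq_mul, map_smul_eq_mul, h3]
  norm_num
  ring

theorem cfc_fromBlocks (f : ℝ → ℝ) {A : Matrix m m ℂ} {B : Matrix n n ℂ} (hA : A.IsHermitian)
    (hB : B.IsHermitian) :
    cfc f (fromBlocks A 0 0 B) = fromBlocks (cfc f A) 0 0 (cfc f B) := by
  obtain ⟨U, hU, hUA⟩ := exists_conj_realDiag hA
  obtain ⟨V, hV, hVB⟩ := exists_conj_realDiag hB
  have h : ∀ (d : m → ℝ) (e : n → ℝ),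
      fromBlocks (U * realDiag d * Uᴴ) 0 0 (V * realDiag e * Vᴴ) =
        fromBlocks U 0 0 V * realDiag (Sum.elim d e) * (fromBlocks U 0 0 V)ᴴ := by
    intro d e
    have : realDiag (Sum.elim d e) = fromBlocks (realDiag d) 0 0 (realDiag e) := by
      rw [realDiag, realDiag, realDiag, fromBlocks_diagonal]
      congr 1
      ext i
      cases i <;> rfl
    rw [this]
    simp [fromBlocks_conjTranspose, fromBlocks_multiply]
  rw [hUA, hVB, h, cfc_conj_realDiag (hU.fromBlocks hV), cfc_conj_realDiag hU,
    cfc_conj_realDiag hV, h]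
  congr 3
  ext i
  cases i <;> rfl

theorem sum_concave_add_le_sum_eigenvalues {f : ℝ → ℝ} (hf : ConcaveOn ℝ (Ici 0) f)
    (hf0 : MapsTo f (Ici 0) (Ici 0)) {N : ℕ} {E V : Matrix m (Fin N) ℂ} (hE : IsUnitaryFrame E)
    {s c : Fin N → ℝ} (hs : ∀ i, 0 ≤ s i) (hanti : Antitone s) {A B C : Matrix m m ℂ}
    (hA : A.PosSemidef) (hB : B.PosSemidef) (hAB : A + B = E * realDiag s * Eᴴ)
    (hV : IsUnitaryFrame V) (hc : Antitone c) (hC : C = V * realDiag c * Vᴴ)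
    (hABC : (C - (cfc f A + cfc f B - (f 0 : ℂ) • 1)).PosSemidef) {k : ℕ} (hk : k ≤ N) :
    ∑ j : Fin k, f (s (Fin.castLE hk j)) ≤ ∑ j : Fin k, c (Fin.castLE hk j) := by
  refine (sum_concave_add_le hf hf0 hE hs hanti hA hB hAB hk).trans
    (le_trans (Finset.sum_le_sum fun j _ => ?_) (sum_diag_le_sum_eigenvalues hV hE hc hk))
  have h := (hABC.conjTranspose_mul_mul_same E).diag_nonneg (i := Fin.castLE hk j)
  rw [Matrix.mul_sub, Matrix.sub_mul, Matrix.mul_sub, Matrix.sub_mul, Matrix.mul_smul,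
    Matrix.smul_mul, Matrix.mul_one, hE.1] at h
  have h' := (Complex.le_def.1 h).1
  simp only [Matrix.sub_apply, Matrix.smul_apply, one_apply_eq, smul_eq_mul, mul_one,
    Complex.sub_re, Complex.ofReal_re, Complex.zero_re] at h'
  rw [← hC]
  linarith

/-- A norm inequality for `f(|X * Y|)`, given positive semidefinite decompositions of `X * Xᴴ` and
`Yᴴ * Y`. -/
theorem IsSymmetricNorm.funAbs_mul_le {p : Seminorm ℂ (Matrix m m ℂ)} (hp : IsSymmetricNorm p)
    {f : ℝ → ℝ} (hf0 : MapsTo f (Ici 0) (Ici 0)) (hf : ConcaveOn ℝ (Ici 0) f) (hfe : EConvex f)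
    (X : Matrix m κ ℂ) (Y : Matrix κ m ℂ) {A₁ B₁ C₁ A₂ B₂ C₂ : Matrix m m ℂ}
    (hA₁ : A₁.PosSemidef) (hB₁ : B₁.PosSemidef) (hC₁ : C₁.PosSemidef)
    (hA₂ : A₂.PosSemidef) (hB₂ : B₂.PosSemidef) (hC₂ : C₂.PosSemidef)
    (hX : X * Xᴴ = A₁ + B₁) (hY : Yᴴ * Y = A₂ + B₂)
    (h₁ : (C₁ - (cfc f A₁ + cfc f B₁ - (f 0 : ℂ) • 1)).PosSemidef)
    (h₂ : (C₂ - (cfc f A₂ + cfc f B₂ - (f 0 : ℂ) • 1)).PosSemidef) :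
    p (funAbs f (X * Y)) ≤ (p C₁ + p C₂) / 2 := by
  have hmono := hf.monotoneOn_of_nonneg hf0
  obtain ⟨U, V, s, hU, hV, hs_anti, hs, hXY⟩ := exists_sorted_svd rfl (X * Y)
  obtain ⟨E₁, α, hE₁, hα_anti, hα, hE₁X⟩ := exists_sorted_conj_realDiag rfl (hA₁.add hB₁)
  obtain ⟨E₂, β, hE₂, hβ_anti, hβ, hE₂Y⟩ := exists_sorted_conj_realDiag rfl (hA₂.add hB₂)
  obtain ⟨V₁, c, hV₁, hc_anti, -, hV₁C⟩ := exists_sorted_conj_realDiag rfl hC₁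
  obtain ⟨V₂, d, hV₂, hd_anti, -, hV₂C⟩ := exists_sorted_conj_realDiag rfl hC₂
  -- Both bounds live in one frame V: averaging the sorted spectra of C₁ and C₂ there lets the
  -- triangle inequality split the norm.
  have hmaj : ∀ (k : ℕ) (hk : k ≤ Fintype.card m),
      ∑ i : Fin k, f (s (Fin.castLE hk i)) ≤
        ∑ i : Fin k, (1 / 2 * c (Fin.castLE hk i) + 1 / 2 * d (Fin.castLE hk i)) := by
    intro k hk
    have hhorn := hfe.sum_le_of_prod_le hmono (k := k) (s := fun i => s (Fin.castLE hk i))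
      (α := fun i => α (Fin.castLE hk i)) (β := fun i => β (Fin.castLE hk i))
      (fun i => hs _) (fun i => hα _) (fun i => hβ _)
      (fun i j hij => hs_anti (show Fin.castLE hk i ≤ Fin.castLE hk j from hij))
      fun l hl => prod_sq_le_of_mul hU hV hE₁ hE₂ hα hβ hα_anti hβ_anti hXY
        (hX.trans hE₁X) (hY.trans hE₂Y) (hl.trans hk)
    have hc := sum_concave_add_le_sum_eigenvalues hf hf0 hE₁ hα hα_anti hA₁ hB₁ hE₁X hV₁ hc_anti
      hV₁C h₁ hk
    have hd := sum_concave_add_le_sum_eigenvalues hf hf0 hE₂ hβ hβ_anti hA₂ hB₂ hE₂Y hV₂ hd_anti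
      hV₂C h₂ hk
    rw [← Finset.sum_div, Finset.sum_add_distrib] at hhorn
    rw [Finset.sum_add_distrib, ← Finset.mul_sum, ← Finset.mul_sum]
    linarith
  rw [hXY, funAbs_mul_realDiag_mul hU hV hs]
  refine (hp.realDiag_le hV (x := fun i => f (s i))
    (y := fun i => 1 / 2 * c i + 1 / 2 * d i)
    (fun i j hij => hmono (hs j) (hs i) (hs_anti hij)) (fun i => hf0 (hs i)) hmaj).trans ?_
  rw [realDiag_add, realDiag_smul, realDiag_smul, Matrix.mul_add, Matrix.add_mul, Matrix.mul_smul,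
    Matrix.smul_mul, Matrix.mul_smul, Matrix.smul_mul]
  refine (map_add_le_add p _ _).trans (le_of_eq ?_)
  rw [map_smul_eq_mul, map_smul_eq_mul, hV₁C, hV₂C, hp.frame_eq hV hV hV₁ hV₁,
    hp.frame_eq hV hV hV₂ hV₂]
  norm_num
  ring

/-- This is |N*| = |N|: take square roots in NN* = N*N. -/
theorem conj_realDiag_eq_of_isStarNormal {U V : Matrix n n ℂ} (hU : IsUnitaryFrame U)
    (hV : IsUnitaryFrame V) {s : n → ℝ} (hs : ∀ i, 0 ≤ s i)
    (hN : IsStarNormal (U * realDiag s * Vᴴ)) :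
    U * realDiag s * Uᴴ = V * realDiag s * Vᴴ := by
  have h := hN.star_comm_self.eq
  have e1 : star (U * realDiag s * Vᴴ) * (U * realDiag s * Vᴴ) =
      V * realDiag (fun i => s i * s i) * Vᴴ := by
    rw [← realDiag_mul_realDiag, star_eq_conjTranspose]
    simp only [conjTranspose_mul, conjTranspose_conjTranspose, realDiag_conjTranspose]
    calc _ = V * realDiag s * (Uᴴ * U) * realDiag s * Vᴴ := by simp only [Matrix.mul_assoc]
      _ = _ := by rw [hU.1]; simp only [Matrix.mul_assoc, Matrix.one_mul]
  have e2 : (U * realDiag s * Vᴴ) * star (U * realDiag s * Vᴴ) =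
      U * realDiag (fun i => s i * s i) * Uᴴ := by
    rw [← realDiag_mul_realDiag, star_eq_conjTranspose]
    simp only [conjTranspose_mul, conjTranspose_conjTranspose, realDiag_conjTranspose]
    calc _ = U * realDiag s * (Vᴴ * V) * realDiag s * Uᴴ := by simp only [Matrix.mul_assoc]
      _ = _ := by rw [hV.1]; simp only [Matrix.mul_assoc, Matrix.one_mul]
  rw [e1, e2] at h
  have h' := congrArg (cfc Real.sqrt) h
  rw [cfc_conj_realDiag hU, cfc_conj_realDiag hV] at h'
  simp only [Real.sqrt_mul_self (hs _)] at h'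
  exact h'.symm

theorem posSemidef_fromBlocks {A : Matrix m m ℂ} {B : Matrix n n ℂ} (hA : A.PosSemidef)
    (hB : B.PosSemidef) : (fromBlocks A 0 0 B).PosSemidef := by
  obtain ⟨K, -, rfl⟩ := exists_isHermitian_mul_self hA
  obtain ⟨L, -, rfl⟩ := exists_isHermitian_mul_self hB
  have := posSemidef_conjTranspose_mul_self (fromBlocks K 0 0 L)
  simpa [fromBlocks_conjTranspose, fromBlocks_multiply] using this

theorem IsSymmetricNorm.fromBlocks_frame_eq {p : Seminorm ℂ (Matrix (n ⊕ n) (n ⊕ n) ℂ)}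
    (hp : IsSymmetricNorm p) {U V U' V' : Matrix n n ℂ} (hU : IsUnitaryFrame U)
    (hV : IsUnitaryFrame V) (hU' : IsUnitaryFrame U') (hV' : IsUnitaryFrame V')
    (D D' : Matrix n n ℂ) :
    p (fromBlocks (U * D * Uᴴ) 0 0 (U' * D' * U'ᴴ)) =
      p (fromBlocks (V * D * Vᴴ) 0 0 (V' * D' * V'ᴴ)) := by
  have h := hp.frame_eq (hU.fromBlocks hU') (hU.fromBlocks hU') (hV.fromBlocks hV')
    (hV.fromBlocks hV') (fromBlocks D 0 0 D')
  simpa [fromBlocks_conjTranspose, fromBlocks_multiply] using h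

end SymmetricNorms

/-! ### The block triangular matrix. -/

open Matrix in
open scoped ComplexOrder in
theorem corollary2p3 {n : Type*} [Fintype n] [DecidableEq n]
    (A N B : Matrix n n ℂ) (hN : IsStarNormal N)
    (f : ℝ → ℝ) (hf_nonneg : MapsTo f (Ici 0) (Ici 0))
    (hf_concave : ConcaveOn ℝ (Ici 0) f) (hf_econvex : EConvex f)
    (p : Seminorm ℂ (Matrix (n ⊕ n) (n ⊕ n) ℂ)) (hp : IsSymmetricNorm p) :
    p (funAbs f (Matrix.fromBlocks A N 0 B)) ≤
      padNorm p (funAbs f (A.conjTranspose) + funAbs f N + funAbs f B) := by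
  obtain ⟨UA, VA, a, hUA, hVA, ha, rfl⟩ := exists_svd A
  obtain ⟨UN, VN, ν, hUN, hVN, hν, rfl⟩ := exists_svd N
  obtain ⟨UB, VB, b, hUB, hVB, hb, rfl⟩ := exists_svd B
  have hA' : (UA * realDiag a * VAᴴ)ᴴ = VA * realDiag a * UAᴴ := by
    simp only [conjTranspose_mul, conjTranspose_conjTranspose, realDiag_conjTranspose,
      Matrix.mul_assoc]
  have hnorm := conj_realDiag_eq_of_isStarNormal hUN hVN hν hN
  rw [hA', funAbs_mul_realDiag_mul hVA hUA ha, funAbs_mul_realDiag_mul hUN hVN hν,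
    funAbs_mul_realDiag_mul hUB hVB hb]
  let r (d : n → ℝ) : Matrix n n ℂ := realDiag fun i => Real.sqrt (d i)
  have hr : ∀ d : n → ℝ, (r d)ᴴ = r d := fun d => realDiag_conjTranspose _
  have hrr : ∀ {d : n → ℝ}, (∀ i, 0 ≤ d i) → ∀ Q R : Matrix n n ℂ,
      Q * r d * (r d * R) = Q * realDiag d * R := fun {d} hd Q R => by
    rw [Matrix.mul_assoc Q, ← Matrix.mul_assoc (r d), realDiag_mul_realDiag, ← Matrix.mul_assoc]
    simp only [Real.mul_self_sqrt (hd _)]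
  -- Each of A, N, B is split as (U√s)(√s V*), with a separate middle summand for each, so no cross
  -- terms appear in XX* or Y*Y beyond the diagonal blocks.
  let X : Matrix (n ⊕ n) (n ⊕ (n ⊕ n)) ℂ :=
    fromBlocks (UA * r a) (fromCols (UN * r ν) 0) 0 (fromCols 0 (UB * r b))
  let Y : Matrix (n ⊕ (n ⊕ n)) (n ⊕ n) ℂ :=
    fromBlocks (r a * VAᴴ) 0 0 (fromRows (r ν * VNᴴ) (r b * VBᴴ))
  have hXY : X * Y = fromBlocks (UA * realDiag a * VAᴴ) (UN * realDiag ν * VNᴴ) 0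
      (UB * realDiag b * VBᴴ) := by
    simp [X, Y, fromBlocks_multiply, fromCols_mul_fromRows, hrr ha, hrr hν, hrr hb]
  have hX : X * Xᴴ = fromBlocks (UA * realDiag a * UAᴴ) 0 0 (UB * realDiag b * UBᴴ) +
      fromBlocks (VN * realDiag ν * VNᴴ) 0 0 0 := by
    simp [X, fromBlocks_conjTranspose, fromBlocks_multiply, fromCols_mul_fromRows,
      conjTranspose_fromCols_eq_fromRows_conjTranspose, hr, hrr ha, hrr hν, hrr hb, hnorm,
      fromBlocks_add]
  have hY : Yᴴ * Y = fromBlocks (VA * realDiag a * VAᴴ) 0 0 (VN * realDiag ν * VNᴴ) +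
      fromBlocks 0 0 0 (VB * realDiag b * VBᴴ) := by
    simp [Y, fromBlocks_conjTranspose, fromBlocks_multiply, fromCols_mul_fromRows,
      conjTranspose_fromRows_eq_fromCols_conjTranspose, hr, hrr ha, hrr hν, hrr hb,
      fromBlocks_add]
  have psd : ∀ (W : Matrix n n ℂ) {d : n → ℝ}, (∀ i, 0 ≤ d i) →
      (W * realDiag d * Wᴴ).PosSemidef := fun W _ hd => posSemidef_conj_realDiag W hd
  have hf0 : 0 ≤ f 0 := hf_nonneg (mem_Ici.2 le_rfl)
  have hfd : ∀ {d : n → ℝ}, (∀ i, 0 ≤ d i) → ∀ i, 0 ≤ f (d i) := fun hd i => hf_nonneg (hd i)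
  have hconst : ((f 0 : ℂ) • (1 : Matrix n n ℂ)).PosSemidef :=
    PosSemidef.one.smul (by exact_mod_cast hf0)
  have hzero : cfc f (0 : Matrix n n ℂ) = (f 0 : ℂ) • 1 := by
    rw [cfc_apply_zero, Algebra.algebraMap_eq_smul_one]
    rfl
  have hcfc : ∀ {W : Matrix n n ℂ}, IsUnitaryFrame W → ∀ d : n → ℝ,
      cfc f (W * realDiag d * Wᴴ) = W * realDiag (fun i => f (d i)) * Wᴴ :=
    fun hW d => cfc_conj_realDiag hW d f
  have hone : (1 : Matrix (n ⊕ n) (n ⊕ n) ℂ) = fromBlocks 1 0 0 1 := fromBlocks_one.symm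
  set PA := UA * realDiag (fun i => f (a i)) * UAᴴ
  set PN := VN * realDiag (fun i => f (ν i)) * VNᴴ
  set PB := VB * realDiag (fun i => f (b i)) * VBᴴ
  have hPA : PA.PosSemidef := psd UA (hfd ha)
  have hPN : PN.PosSemidef := psd VN (hfd hν)
  have hPB : PB.PosSemidef := psd VB (hfd hb)
  -- With these C₁ and C₂ the defects in the two positivity conditions are f(0) ⊕ 0 and 0 ⊕ f(0): in
  -- the block where two nonzero summands meet, -f(0) is simply discarded, and in the other it
  -- cancels the value of f at a zero block.
  have key := hp.funAbs_mul_le hf_nonneg hf_concave hf_econvex X Y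
    (C₁ := fromBlocks (PA + PN) 0 0 (UB * realDiag (fun i => f (b i)) * UBᴴ))
    (C₂ := fromBlocks (VA * realDiag (fun i => f (a i)) * VAᴴ) 0 0 (PN + PB))
    (posSemidef_fromBlocks (psd UA ha) (psd UB hb))
    (posSemidef_fromBlocks (psd VN hν) PosSemidef.zero)
    (posSemidef_fromBlocks (hPA.add hPN) (psd UB (hfd hb)))
    (posSemidef_fromBlocks (psd VA ha) (psd VN hν))
    (posSemidef_fromBlocks PosSemidef.zero (psd VB hb))
    (posSemidef_fromBlocks (psd VA (hfd ha)) (hPN.add hPB)) hX hY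
    (by
      rw [cfc_fromBlocks f (psd UA ha).1 (psd UB hb).1,
        cfc_fromBlocks f (psd VN hν).1 isHermitian_zero, hcfc hUA, hcfc hUB, hcfc hVN, hzero, hone]
      convert posSemidef_fromBlocks hconst (PosSemidef.zero (n := n) (R := ℂ)) using 1
      rw [fromBlocks_add, fromBlocks_smul, sub_eq_iff_eq_add, sub_eq_add_neg, fromBlocks_neg,
        fromBlocks_add, fromBlocks_add]
      congr 1 <;> simp [PA, PN])
    (by
      rw [cfc_fromBlocks f (psd VA ha).1 (psd VN hν).1,
        cfc_fromBlocks f isHermitian_zero (psd VB hb).1, hcfc hVA, hcfc hVB, hcfc hVN, hzero, hone]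
      convert posSemidef_fromBlocks (PosSemidef.zero (n := n) (R := ℂ)) hconst using 1
      rw [fromBlocks_add, fromBlocks_smul, sub_eq_iff_eq_add, sub_eq_add_neg, fromBlocks_neg,
        fromBlocks_add, fromBlocks_add]
      congr 1 <;> simp [PB, PN])
  have hid : IsUnitaryFrame (1 : Matrix n n ℂ) := ⟨by simp, by simp⟩
  -- Independent unitaries on the two blocks replace f(|B*|) by f(|B|) and f(|A|) by f(|A*|), which
  -- is possible only while these stand alone in a block.
  have h1 := hp.fromBlocks_frame_eq hid hid hUB hVB (PA + PN) (realDiag fun i => f (b i))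
  have h2 := hp.fromBlocks_frame_eq hVA hUA hid hid (realDiag fun i => f (a i)) (PN + PB)
  simp only [conjTranspose_one, Matrix.one_mul, Matrix.mul_one] at h1 h2
  rw [hXY, h1, h2] at key
  have h3 := hp.fromBlocks_le_padNorm (hPA.add hPN) hPB
  have h4 := hp.fromBlocks_le_padNorm hPA (hPN.add hPB)
  rw [← add_assoc] at h4
  linarith
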